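/- Let $(\Omega,\mathcal F,m)$ be a probability space, $\rho>0$, and let $f:[0,\infty)\to(-\infty,+\infty]$ be convex and finite in a neighbourhood of $1$ (set $f=+\infty$ on $(-\infty,0)$). For a probability measure $\tilde m\ll m$ put $D_f(\tilde m\,\|\,m)=\int_\Omega f\!\left(\frac{d\tilde m}{dm}\right)dm-f(1)$, and let $$B_\rho(m)=\{\tilde m \text{ probability measure}:\ \tilde m\ll m,\ D_f(\tilde m\,\|\,m)\le\rho\}.$$ Consider a game with finitely many players $j$. Player $j$ has an action set $\mathcal A_j$ in a finite-dimensional real normed space and a loss $l_j(a,\omega)\in\mathbb R$, where $a\in\mathcal A=\prod_k\mathcal A_k$, such that $l_j(a,\cdot)$ is $\tilde m$-integrable for all $a\in\mathcal A$ and $\tilde m\in B_\rho(m)$. A profile $a^*\in\mathcal A$ is a *distributionally robust pure Nash equilibrium* if for every player $j$ and every $a_j\in\mathcal A_j$ $$\sup_{\tilde m\in B_\rho(m)}\mathbb E_{\tilde m}\,l_j(a^*,\omega)\ \le\ \sup_{\tilde m\in B_\rho(m)}\mathbb E_{\tilde m}\,l_j(a_j,a^*_{-j},\omega).$$ With $f^*(\xi)=\sup_x[x\xi-f(x)]$,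 define for $a\in\mathcal A$, $\lambda>0$, $\mu\in\mathbb R$ the reduced cost $$l_j^*(a,\lambda,\mu,m)=\lambda(\rho+f(1))+\mu+\int_\Omega\lambda f^*\!\left(\frac{l_j(a,\omega)-\mu}{\lambda}\right)dm(\omega)\in(-\infty,+\infty],$$ and $l_j^*(a,m)=\inf_{\lambda>0,\ \mu\in\mathbb R}l_j^*(a,\lambda,\mu,m)$. Assume that every $\mathcal A_j$ is nonempty, compact and convex, and that at least one of the following holds: 1. for every $j$, $l_j^*(\cdot,m)$ is continuous on $\mathcal A\times(0,\infty)\times\mathbb R$, and for every $a_{-j}\in\prod_{k\ne j}\mathcal A_k$ the function $(a_j,\lambda,\mu)\mapsto l_j^*(a_j,a_{-j},\lambda,\mu,m)$ is quasi-convex on $\mathcal A_j\times(0,\infty)\times\mathbb R$; 2. for every $j$, $a\mapsto l_j^*(a,m)$ is continuous on $\mathcal A$, and for every $a_{-j}\in\prod_{k\ne j}\mathcal A_k$ the function $a_j\mapsto l_j^*(a_j,a_{-j},m)$ is quasi-convex on $\mathcal A_j$. (Continuity is with respect to the usual topology of $[-\infty,+\infty]$.) Then the game has at least one distributionally robust pure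 Nash equilibrium. -/

import Mathlib

open MeasureTheory Set
open scoped ENNReal

/-- Integral of an extended-real-valued function: integral of the positive part minus integral of
the negative part. It is only used below for functions whose negative part has finite integral. -/
noncomputable def extIntegral {Ω : Type*} [MeasurableSpace Ω] (m : Measure Ω) (g : Ω → EReal) :
    EReal :=
  ((∫⁻ ω, (g ω).toENNReal ∂m : ℝ≥0∞) : EReal) - ((∫⁻ ω, (-g ω).toENNReal ∂m : ℝ≥0∞) : EReal)

/-- Generators of `f`-divergences: proper convex functions `f : [0, ∞) → (-∞, +∞]`, extended by
`+∞` to the negative half-line, that are finite in a neighbourhood of `1`. -/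
structure IsDivergenceGenerator (f : ℝ → EReal) : Prop where
  eq_top_of_neg : ∀ x < 0, f x = ⊤
  ne_bot : ∀ x, f x ≠ ⊥
  convex_epigraph : Convex ℝ {p : ℝ × ℝ | f p.1 ≤ (p.2 : EReal)}
  finite_near_one : 1 ∈ interior {x : ℝ | f x ≠ ⊤}

/-- The Legendre-Fenchel transform `f^*(ξ) = sup_x [x ξ - f(x)]`. -/
noncomputable def legendreFenchel (f : ℝ → EReal) (ξ : ℝ) : EReal :=
  ⨆ x : ℝ, ((x * ξ : ℝ) : EReal) - f x

/-- The `f`-divergence `D_f(m' ‖ m) = ∫ f(dm'/dm) dm - f(1)`, for `m'` absolutely continuous with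
respect to `m`. -/
noncomputable def fDivergence {Ω : Type*} [MeasurableSpace Ω] (f : ℝ → EReal)
    (m' m : Measure Ω) : EReal :=
  extIntegral m (fun ω => f (m'.rnDeriv m ω).toReal) - f 1

/-- The uncertainty set `B_ρ(m)`: all probability measures, absolutely continuous with respect to
`m`, whose `f`-divergence from `m` is at most `ρ`. -/
def uncertaintySet {Ω : Type*} [MeasurableSpace Ω] (f : ℝ → EReal) (ρ : ℝ) (m : Measure Ω) :
    Set (Measure Ω) :=
  {m' | IsProbabilityMeasure m' ∧ m' ≪ m ∧ fDivergence f m' m ≤ (ρ : EReal)}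

/-- The worst-case expected loss `sup_{m' ∈ B_ρ(m)} E_{m'} X`. -/
noncomputable def worstCaseLoss {Ω : Type*} [MeasurableSpace Ω] (f : ℝ → EReal) (ρ : ℝ)
    (m : Measure Ω) (X : Ω → ℝ) : EReal :=
  ⨆ m' ∈ uncertaintySet f ρ m, ((∫ ω, X ω ∂m' : ℝ) : EReal)

/-- A distributionally robust pure Nash equilibrium of the game with action sets `A j` and losses
`l j a ω` (`j` the player, `a` the action profile, `ω` the state). -/
def IsRobustPureEquilibrium {ι : Type*} [DecidableEq ι] {E : ι → Type*} {Ω : Type*}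
    [MeasurableSpace Ω] (f : ℝ → EReal) (ρ : ℝ) (m : Measure Ω) (A : ∀ j, Set (E j))
    (l : ι → (∀ j, E j) → Ω → ℝ) (a : ∀ j, E j) : Prop :=
  a ∈ univ.pi A ∧ ∀ j, ∀ b ∈ A j,
    worstCaseLoss f ρ m (l j a) ≤ worstCaseLoss f ρ m (l j (Function.update a j b))

/-- The reduced cost `lam (ρ + f(1)) + μ + ∫ lam f^*((X - μ) / lam) dm` of a random loss `X`, for
multipliers `lam > 0` and `μ`. -/
noncomputable def reducedCost {Ω : Type*} [MeasurableSpace Ω] (f : ℝ → EReal) (ρ : ℝ)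
    (m : Measure Ω) (X : Ω → ℝ) (lam μ : ℝ) : EReal :=
  (lam : EReal) * ((ρ : EReal) + f 1) + (μ : EReal) +
    extIntegral m (fun ω => (lam : EReal) * legendreFenchel f ((X ω - μ) / lam))

/-- The reduced cost minimized over the multipliers. -/
noncomputable def minReducedCost {Ω : Type*} [MeasurableSpace Ω] (f : ℝ → EReal) (ρ : ℝ)
    (m : Measure Ω) (X : Ω → ℝ) : EReal :=
  ⨅ (lam : ℝ) (_ : 0 < lam) (μ : ℝ), reducedCost f ρ m X lam μ

/-! By Lagrangian duality the worst-case loss of a profile equals its minimised reduced cost, and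
the common value is real (`exists_worstCaseLoss_eq_minReducedCost`). A robust equilibrium is
therefore an ordinary pure Nash equilibrium of a game with real continuous costs, quasiconvex in the
own action; such a game has one (`exists_pure_equilibrium`).

Duality: the reduced cost is a supremum of Lagrangians, affine in the multipliers, over simple
functions with values in the epigraph of `f` (`reducedCost_le_iff`). The attainable triples
(expected loss, divergence, mass) form a convex set, and two scalar separations produce the
multipliers: the density 1 is a Slater point because `0 < ρ`, and the mass can move both ways
because `f` is finite around 1. The worst case is finite because the uncertainty set is closed under
countable mixtures containing `m`: unbounded expectations would combine into one measure of the set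
for which the loss is not integrable.

Equilibria: against finitely many deviations, a convex combination reweighted towards nearly best
replies has a fixed point by Brouwer's theorem, and quasiconvexity makes it an approximate
equilibrium; compactness removes the approximation. Brouwer's theorem comes from Scarf's lemma, a
Sperner-type parity count.

The joint assumption on (action, multipliers) reduces to the one on minimised costs: minimising
keeps quasiconvexity, and it keeps continuity because the reduced cost is convex and coercive in the
multipliers (`continuous_iInf_multipliers`). -/

/-! ### Scarf's lemma: parity counting of rooms and doors. -/

/-- A set `S` is dominant for the family `k` of rankings if every element is ranked weakly below
all of `S` by at least one of the rankings. -/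
def RankDominant {V I : Type*} (k : I → V → ℕ) (S : Finset V) : Prop :=
  ∀ y, ∃ i, ∀ s ∈ S, k i y ≤ k i s

theorem RankDominant.mono {V I : Type*} {k : I → V → ℕ} {S S' : Finset V}
    (h : RankDominant k S') (hS : S ⊆ S') : RankDominant k S :=
  fun y => (h y).imp fun _ hi s hs => hi s (hS hs)

/-- A Sperner-type parity argument for an abstract family `R` of rooms. -/
theorem exists_image_eq_univ_of_parity {V I : Type*} [Fintype V] [DecidableEq V] [Fintype I]
    [DecidableEq I] (R : Finset (Finset V)) (c : V → I) (i₀ : I) (d₀ : Finset V)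
    (hR : ∀ S ∈ R, S.card = Fintype.card I)
    (hd₀ : d₀.image c = Finset.univ.erase i₀) (hd₀c : d₀.card + 1 = Fintype.card I)
    (hodd : Odd (R.filter (d₀ ⊆ ·)).card)
    (heven : ∀ d : Finset V, d ≠ d₀ → d.image c = Finset.univ.erase i₀ →
      d.card + 1 = Fintype.card I → Even (R.filter (d ⊆ ·)).card) :
    ∃ S ∈ R, S.image c = Finset.univ := by
  by_contra! hcon
  -- Double counting of incidences between rooms and doors, a door carrying exactly the colours
  -- other than `i₀`. Counted by doors the total is odd; counted by rooms it is even if no room is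
  -- fully coloured.
  set D : Finset (Finset V) := Finset.univ.filter fun d =>
    d.image c = Finset.univ.erase i₀ ∧ d.card + 1 = Fintype.card I with hD
  have hcount := Finset.sum_card_bipartiteAbove_eq_sum_card_bipartiteBelow
    (s := D) (t := R) (fun d S => d ⊆ S)
  have hleft : Odd (∑ d ∈ D, (R.bipartiteAbove (fun d S => d ⊆ S) d).card) := by
    have hmem : d₀ ∈ D := by simp [hD, hd₀, hd₀c]
    rw [← Finset.add_sum_erase _ _ hmem]
    refine Odd.add_even hodd (Finset.even_sum _ fun d hd => ?_)
    simp only [hD, Finset.mem_erase, Finset.mem_filter, Finset.mem_univ, true_and] at hd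
    exact heven d hd.1 hd.2.1 hd.2.2
  have hright : Even (∑ S ∈ R, (D.bipartiteBelow (fun d S => d ⊆ S) S).card) := by
    refine Finset.even_sum _ fun S hS => ?_
    by_cases hne : (D.bipartiteBelow (fun d S => d ⊆ S) S).Nonempty
    swap
    · rw [Finset.not_nonempty_iff_eq_empty.mp hne]; simp
    have herase : ∀ d ∈ D.bipartiteBelow (fun d S => d ⊆ S) S, ∃ v ∈ S, d = S.erase v := by
      intro d hd
      simp only [Finset.bipartiteBelow, hD, Finset.mem_filter, Finset.mem_univ, true_and] at hd
      obtain ⟨⟨-, hcard⟩, hsub⟩ := hd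
      have h1 : (S \ d).card = 1 := by
        rw [Finset.card_sdiff_of_subset hsub, hR S hS]; omega
      obtain ⟨v, hv⟩ := Finset.card_eq_one.mp h1
      have hvS : v ∈ S \ d := by rw [hv]; simp
      refine ⟨v, (Finset.mem_sdiff.mp hvS).1, ?_⟩
      rw [← Finset.sdiff_singleton_eq_erase, ← hv, Finset.sdiff_sdiff_eq_self hsub]
    have hmem : ∀ v ∈ S, (S.erase v ∈ D.bipartiteBelow (fun d S => d ⊆ S) S ↔
        (S.erase v).image c = Finset.univ.erase i₀) := by
      intro v hv
      have hpos := Finset.card_pos.mpr ⟨v, hv⟩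
      simp only [Finset.bipartiteBelow, hD, Finset.mem_filter, Finset.mem_univ, true_and,
        Finset.erase_subset, and_true, Finset.card_erase_of_mem hv, and_iff_left_iff_imp]
      intro _
      rw [← hR S hS]; omega
    obtain ⟨d, hd⟩ := hne
    obtain ⟨v, hv, rfl⟩ := herase d hd
    have himg := (hmem v hv).mp hd
    -- A room with a door `S.erase v` that is not fully coloured repeats the colour of `v` at
    -- exactly one other element `w`, so its doors are those omitting `v` or `w`.
    have hcv : c v ≠ i₀ := by
      intro h
      refine hcon S hS ?_
      rw [← Finset.insert_erase hv, Finset.image_insert, himg, h]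
      exact Finset.insert_erase (Finset.mem_univ _)
    have hcv' : c v ∈ (S.erase v).image c := by rw [himg]; simp [hcv]
    obtain ⟨w, hw, hwv⟩ := Finset.mem_image.mp hcv'
    have hwS := Finset.mem_of_mem_erase hw
    have hwne := Finset.ne_of_mem_erase hw
    have hinj : Set.InjOn c (S.erase v : Finset V) := by
      refine Finset.injOn_of_card_image_eq ?_
      rw [himg, Finset.card_erase_of_mem hv, hR S hS, Finset.card_erase_of_mem (Finset.mem_univ _),
        Finset.card_univ]
    have himgw : (S.erase w).image c = Finset.univ.erase i₀ := by
      rw [← himg]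
      ext i
      simp only [Finset.mem_image, Finset.mem_erase]
      constructor
      · rintro ⟨x, ⟨hx1, hx2⟩, rfl⟩
        by_cases hxv : x = v
        · exact ⟨w, ⟨hwne, hwS⟩, by rw [hwv, hxv]⟩
        · exact ⟨x, ⟨hxv, hx2⟩, rfl⟩
      · rintro ⟨x, ⟨hx1, hx2⟩, rfl⟩
        by_cases hxw : x = w
        · exact ⟨v, ⟨hwne.symm, hv⟩, by rw [← hwv, hxw]⟩
        · exact ⟨x, ⟨hxw, hx2⟩, rfl⟩
    have hpair : D.bipartiteBelow (fun d S => d ⊆ S) S = {S.erase v, S.erase w} := by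
      ext d
      rw [Finset.mem_insert, Finset.mem_singleton]
      constructor
      · intro hd'
        obtain ⟨u, hu, rfl⟩ := herase d hd'
        by_contra! hne
        have huv : u ≠ v := fun h => hne.1 (by rw [h])
        have huw : u ≠ w := fun h => hne.2 (by rw [h])
        have h1 := (hmem u hu).mp hd'
        have hinj' : Set.InjOn c (S.erase u : Finset V) := by
          refine Finset.injOn_of_card_image_eq ?_
          rw [h1, Finset.card_erase_of_mem hu, hR S hS,
            Finset.card_erase_of_mem (Finset.mem_univ _), Finset.card_univ]
        exact hwne (hinj' (by simp [huw.symm, hwS]) (by simp [huv.symm, hv]) hwv)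
      · rintro (rfl | rfl)
        · exact hd
        · exact (hmem w hwS).mpr himgw
    rw [hpair, Finset.card_pair]
    · exact even_two
    · intro h
      have : w ∈ S.erase w := h ▸ hw
      simp at this
  rw [hcount] at hleft
  exact (Nat.not_even_iff_odd.mpr hleft) hright

/-- The rooms above a dominant door: with `a ≠ b` the two rankings whose minimum over the door
coincide, they arise by adding the best element not excluded by the other rankings. -/
theorem rankDominant_insert_iff {V I : Type*} [DecidableEq V] [Fintype I]
    [DecidableEq I] {k : I → V → ℕ} (hk : ∀ i, Function.Injective (k i)) {d : Finset V}
    (hcard : d.card + 1 = Fintype.card I) {m : I → V}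
    (hm : ∀ i, m i ∈ d) (hmin : ∀ i, ∀ s ∈ d, k i (m i) ≤ k i s) (hsurj : ∀ v ∈ d, ∃ i, m i = v)
    {a b : I} (hab : a ≠ b) (hmab : m a = m b) {x : V} (hdom : RankDominant k d) :
    (x ∉ d ∧ RankDominant k (insert x d)) ↔
      ((∀ i, i ≠ a → k i (m i) < k i x) ∧
        ∀ y, (∀ i, i ≠ a → k i (m i) < k i y) → k a y ≤ k a x) ∨
      ((∀ i, i ≠ b → k i (m i) < k i x) ∧
        ∀ y, (∀ i, i ≠ b → k i (m i) < k i y) → k b y ≤ k b x) := by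
  have hback : ∀ a b : I, a ≠ b → m a = m b →
      ((∀ i, i ≠ a → k i (m i) < k i x) ∧
        ∀ y, (∀ i, i ≠ a → k i (m i) < k i y) → k a y ≤ k a x) →
      (x ∉ d ∧ RankDominant k (insert x d)) := by
    rintro a b hab hmab ⟨hx, hmax⟩
    refine ⟨fun hxd => ?_, fun y => ?_⟩
    · obtain ⟨i, hi⟩ := hsurj x hxd
      by_cases hia : i = a
      · have := hx b hab.symm
        rw [← hmab, ← hia, hi] at this
        exact lt_irrefl _ this
      · have := hx i hia
        rw [hi] at this
        exact lt_irrefl _ this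
    · by_cases hy : ∀ i, i ≠ a → k i (m i) < k i y
      · refine ⟨a, fun s hs => ?_⟩
        rcases Finset.mem_insert.mp hs with rfl | hs
        · exact hmax y hy
        · obtain ⟨i, hi⟩ := hdom x
          have hia : i = a := by
            by_contra hia
            exact absurd (hi _ (hm i)) (not_le.mpr (hx i hia))
          exact (hmax y hy).trans (hia ▸ hi s hs)
      · push Not at hy
        obtain ⟨i, hia, hi⟩ := hy
        refine ⟨i, fun s hs => ?_⟩
        rcases Finset.mem_insert.mp hs with rfl | hs
        · exact hi.trans (hx i hia).le
        · exact hi.trans (hmin i s hs)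
  constructor
  · rintro ⟨hxd, hdomx⟩
    obtain ⟨i, hi⟩ := hdomx x
    -- If `x` were lowest for two rankings `i` and `j`, each point of `d` would have to be lowest
    -- for one of the other `card I - 2` rankings, but `d` has `card I - 1` points.
    have hsub : ∀ j, j ≠ i → k j (m j) < k j x := by
      by_contra! hcon
      obtain ⟨j, hji, hj⟩ := hcon
      have hjs : ∀ s ∈ d, k j x ≤ k j s := fun s hs => hj.trans (hmin j s hs)
      have hsur : ∀ v ∈ d, ∃ l, l ≠ i ∧ l ≠ j ∧ m l = v := by
        intro v hv
        obtain ⟨l, hl⟩ := hdomx v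
        have hxv : x ≠ v := fun h => hxd (h ▸ hv)
        refine ⟨l, ?_, ?_, hk l (le_antisymm (hmin l v hv)
          (hl _ (Finset.mem_insert_of_mem (hm l))))⟩
        · rintro rfl
          exact hxv (hk l (le_antisymm (hi v (Finset.mem_insert_of_mem hv))
            (hl x (Finset.mem_insert_self _ _))))
        · rintro rfl
          exact hxv (hk l (le_antisymm (hjs v hv) (hl x (Finset.mem_insert_self _ _))))
      have hle : d.card ≤ ((Finset.univ.erase i).erase j).card := by
        refine (Finset.card_le_card (t := ((Finset.univ.erase i).erase j).image m) ?_).trans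
          Finset.card_image_le
        intro v hv
        obtain ⟨l, h1, h2, h3⟩ := hsur v hv
        exact Finset.mem_image.mpr ⟨l, by simp [h1, h2], h3⟩
      rw [Finset.card_erase_of_mem (by simp [hji]), Finset.card_erase_of_mem (Finset.mem_univ _),
        Finset.card_univ] at hle
      have : 0 < d.card := Finset.card_pos.mpr ⟨_, hm i⟩
      omega
    have hmax : ∀ y, (∀ j, j ≠ i → k j (m j) < k j y) → k i y ≤ k i x := by
      intro y hy
      obtain ⟨j, hj⟩ := hdomx y
      have hji : j = i := by
        by_contra hji
        exact absurd (hj _ (Finset.mem_insert_of_mem (hm j))) (not_le.mpr (hy j hji))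
      exact hji ▸ hj x (Finset.mem_insert_self _ _)
    by_cases hia : i = a
    · exact Or.inl (hia ▸ ⟨hsub, hmax⟩)
    by_cases hib : i = b
    · exact Or.inr (hib ▸ ⟨hsub, hmax⟩)
    exfalso
    -- The same count: with `i` used up by `x`, and `a`, `b` sharing one minimum, too few distinct
    -- minima remain to cover `d`.
    have hle : d.card ≤ ((Finset.univ.erase i).erase a).card := by
      refine (Finset.card_le_card (t := ((Finset.univ.erase i).erase a).image m) ?_).trans
        Finset.card_image_le
      intro v hv
      obtain ⟨l, hl⟩ := hdomx v
      have hlv : m l = v := hk l (le_antisymm (hmin l v hv)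
          (hl _ (Finset.mem_insert_of_mem (hm l))))
      have hli : l ≠ i := by
        rintro rfl
        have hxv : x ≠ v := fun h => hxd (h ▸ hv)
        exact hxv (hk l (le_antisymm (hi v (Finset.mem_insert_of_mem hv))
            (hl x (Finset.mem_insert_self _ _))))
      by_cases hla : l = a
      · exact Finset.mem_image.mpr ⟨b, by simp [hab.symm, Ne.symm hib], by
          rw [← hmab, ← hla, hlv]⟩
      · exact Finset.mem_image.mpr ⟨l, by simp [hli, hla], hlv⟩
    rw [Finset.card_erase_of_mem (by simp [Ne.symm hia]),
      Finset.card_erase_of_mem (Finset.mem_univ _), Finset.card_univ] at hle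
    have : 0 < d.card := Finset.card_pos.mpr ⟨_, hm i⟩
    omega
  · rintro (h | h)
    · exact hback a b hab hmab h
    · exact hback b a hab.symm hmab.symm h

/-- **Scarf's lemma**, with slack elements `s i` that the `i`-th ranking puts first and all other
rankings put above the non-slack elements. -/
theorem exists_rankDominant_image_eq_univ {V I : Type*} [Fintype V] [DecidableEq V] [Fintype I]
    [DecidableEq I] [Nontrivial I] {k : I → V → ℕ} (hk : ∀ i, Function.Injective (k i))
    (s : I → V) (hs : Function.Injective s)
    (hslow : ∀ i v, v ≠ s i → k i (s i) < k i v)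
    (hshigh : ∀ i j v, j ≠ i → v ∉ range s → k i v < k i (s j))
    (c : V → I) (hc : ∀ i, c (s i) = i) :
    ∃ S : Finset V, S.card = Fintype.card I ∧ RankDominant k S ∧ S.image c = Finset.univ := by
  classical
  obtain ⟨i₀⟩ : Nonempty I := inferInstance
  have hcardI : 1 < Fintype.card I := Fintype.one_lt_card
  set R : Finset (Finset V) := Finset.univ.filter fun S =>
    S.card = Fintype.card I ∧ RankDominant k S with hR
  -- The boundary door: all slack elements but one. It lies in exactly one room, every other door in
  -- zero or two.
  set d₀ : Finset V := (Finset.univ.erase i₀).image s with hd₀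
  have hd₀c : d₀.card + 1 = Fintype.card I := by
    rw [hd₀, Finset.card_image_of_injective _ hs, Finset.card_erase_of_mem (Finset.mem_univ _),
      Finset.card_univ]; omega
  have hd₀i : d₀.image c = Finset.univ.erase i₀ := by
    rw [hd₀, Finset.image_image, show c ∘ s = id from funext hc, Finset.image_id]
  have hrooms : ∀ d : Finset V, d.card + 1 = Fintype.card I →
      R.filter (d ⊆ ·) = (Finset.univ.filter fun x =>
        x ∉ d ∧ RankDominant k (insert x d)).image (insert · d) := by
    intro d hd
    ext S
    simp only [hR, Finset.mem_filter, Finset.mem_univ, true_and, Finset.mem_image]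
    constructor
    · rintro ⟨⟨h1, h2⟩, h3⟩
      have h4 : (S \ d).card = 1 := by rw [Finset.card_sdiff_of_subset h3]; omega
      obtain ⟨x, hx⟩ := Finset.card_eq_one.mp h4
      have hS : insert x d = S := by
        rw [Finset.insert_eq, ← hx, Finset.sdiff_union_of_subset h3]
      have hxm : x ∈ S \ d := by rw [hx]; simp
      exact ⟨x, ⟨(Finset.mem_sdiff.mp hxm).2, hS ▸ h2⟩, hS⟩
    · rintro ⟨x, ⟨hx1, hx2⟩, rfl⟩
      exact ⟨⟨by rw [Finset.card_insert_of_notMem hx1, hd], hx2⟩, Finset.subset_insert _ _⟩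
  have hcardrooms : ∀ d : Finset V, d.card + 1 = Fintype.card I →
      (R.filter (d ⊆ ·)).card = (Finset.univ.filter fun x =>
        x ∉ d ∧ RankDominant k (insert x d)).card := by
    intro d hd
    rw [hrooms d hd, Finset.card_image_of_injOn]
    intro x hx y hy hxy
    rw [Finset.mem_coe, Finset.mem_filter] at hx hy
    have : x ∈ insert y d := by
      have h := Finset.mem_insert_self x d
      simp only at hxy
      rwa [hxy] at h
    exact (Finset.mem_insert.mp this).resolve_right hx.2.1
  -- minima over a door
  have hmins : ∀ d : Finset V, d.card + 1 = Fintype.card I → RankDominant k d →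
      ∃ m : I → V, (∀ i, m i ∈ d) ∧ (∀ i, ∀ v ∈ d, k i (m i) ≤ k i v) ∧
        ∀ v ∈ d, ∃ i, m i = v := by
    intro d hd hdom
    have hne : d.Nonempty := Finset.card_pos.mp (by omega)
    choose m hm hmin using fun i => Finset.exists_min_image d (k i) hne
    refine ⟨m, hm, hmin, fun v hv => ?_⟩
    obtain ⟨i, hi⟩ := hdom v
    exact ⟨i, hk i (le_antisymm (hmin i v hv) (hi _ (hm i)))⟩
  have hbest : ∀ (m : I → V) (a : I), (∃ y, ∀ i, i ≠ a → k i (m i) < k i y) →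
      ∃ x, (∀ i, i ≠ a → k i (m i) < k i x) ∧
        ∀ y, (∀ i, i ≠ a → k i (m i) < k i y) → k a y ≤ k a x := by
    rintro m a ⟨y, hy⟩
    obtain ⟨x, hx, hmax⟩ := Finset.exists_max_image
      (Finset.univ.filter fun y => ∀ i, i ≠ a → k i (m i) < k i y) (k a) ⟨y, by simpa using hy⟩
    simp only [Finset.mem_filter, Finset.mem_univ, true_and] at hx hmax
    exact ⟨x, hx, hmax⟩
  have key := exists_image_eq_univ_of_parity R c i₀ d₀
    (fun S hS => (Finset.mem_filter.mp hS).2.1) hd₀i hd₀c ?_ ?_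
  · obtain ⟨S, hS, hSc⟩ := key
    exact ⟨S, (Finset.mem_filter.mp hS).2.1, (Finset.mem_filter.mp hS).2.2, hSc⟩
  · rw [hcardrooms d₀ hd₀c]
    have hnot : s i₀ ∉ d₀ := by simp [hd₀, hs.eq_iff]
    have hdom : RankDominant k d₀ := by
      intro y
      by_cases hy : y ∈ range s
      · obtain ⟨j, rfl⟩ := hy
        refine ⟨j, fun v hv => ?_⟩
        by_cases hvj : v = s j
        · rw [hvj]
        · exact (hslow j v hvj).le
      · refine ⟨i₀, fun v hv => ?_⟩
        simp only [hd₀, Finset.mem_image, Finset.mem_erase, Finset.mem_univ, and_true] at hv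
        obtain ⟨j, hj, rfl⟩ := hv
        exact (hshigh i₀ j y hj hy).le
    obtain ⟨m, hm, hmin, hsurj⟩ := hmins d₀ hd₀c hdom
    have hms : ∀ i, i ≠ i₀ → m i = s i := by
      intro i hi
      by_contra h
      exact absurd (hmin i (s i) (by simp [hd₀, hs.eq_iff, hi])) (not_le.mpr (hslow i _ h))
    obtain ⟨b, hb, hmb⟩ : ∃ b, b ≠ i₀ ∧ s b = m i₀ := by
      have := hm i₀
      simpa [hd₀] using this
    have hbi : m i₀ = m b := by rw [hms b hb, hmb]
    obtain ⟨x, hx⟩ := hbest m i₀ ⟨s i₀, fun i hi => by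
      rw [hms i hi]; exact hslow i _ (hs.ne hi.symm)⟩
    have : (Finset.univ.filter fun x => x ∉ d₀ ∧ RankDominant k (insert x d₀)) = {x} := by
      ext z
      rw [Finset.mem_filter, rankDominant_insert_iff hk hd₀c hm hmin hsurj hb.symm hbi hdom,
        Finset.mem_singleton]
      simp only [Finset.mem_univ, true_and]
      constructor
      · rintro (h | ⟨h, -⟩)
        · exact hk i₀ (le_antisymm (hx.2 z h.1) (h.2 x hx.1))
        -- The second room would need an element above `s b` in ranking `i₀`. Only slack elements
        -- other than `s i₀` can be, and such an `s j` is not above `m j = s j` in its own ranking.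
        · exfalso
          have hz := h i₀ hb.symm
          rw [← hmb] at hz
          by_cases hzr : z ∈ range s
          · obtain ⟨j, rfl⟩ := hzr
            by_cases hj : j = i₀
            · subst hj
              exact absurd (hslow j (s b) (hs.ne hb)) (not_lt.mpr hz.le)
            · by_cases hjb : j = b
              · subst hjb; exact lt_irrefl _ hz
              · have := h j hjb
                rw [hms j hj] at this
                exact lt_irrefl _ this
          · exact absurd (hshigh i₀ b z hb hzr) (not_lt.mpr hz.le)
      · rintro rfl
        exact Or.inl hx
    rw [this]; simp
  · intro d hdne hdi hd
    rw [hcardrooms d hd]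
    by_cases hdom : RankDominant k d
    swap
    · rw [Finset.card_eq_zero.mpr]
      · simp
      · refine Finset.filter_eq_empty_iff.mpr fun x _ h => hdom (h.2.mono (Finset.subset_insert _ _))
    obtain ⟨m, hm, hmin, hsurj⟩ := hmins d hd hdom
    -- A door made of slack elements alone is `d₀`, by its colours. A non-slack `x₀` makes `s a` a
    -- candidate on either side, so both rooms exist.
    obtain ⟨x₀, hx₀, hx₀s⟩ : ∃ x ∈ d, x ∉ range s := by
      by_contra! hcon
      refine hdne (Finset.eq_of_subset_of_card_le (fun v hv => ?_) (by omega))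
      obtain ⟨j, rfl⟩ := hcon v hv
      have : c (s j) ∈ d.image c := Finset.mem_image_of_mem _ hv
      rw [hdi, hc] at this
      exact Finset.mem_image_of_mem _ this
    obtain ⟨a, b, hab, hmab⟩ : ∃ a b, a ≠ b ∧ m a = m b := by
      obtain ⟨a, -, b, -, h1, h2⟩ := Finset.exists_ne_map_eq_of_card_lt_of_maps_to
        (s := Finset.univ) (t := d) (by rw [Finset.card_univ]; omega) (fun i _ => hm i)
      exact ⟨a, b, h1, h2⟩
    have hslack : ∀ a, ∃ y, ∀ i, i ≠ a → k i (m i) < k i y := fun a =>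
      ⟨s a, fun i hi => (hmin i x₀ hx₀).trans_lt (hshigh i a x₀ hi.symm hx₀s)⟩
    obtain ⟨x, hx⟩ := hbest m a (hslack a)
    obtain ⟨y, hy⟩ := hbest m b (hslack b)
    have : (Finset.univ.filter fun x => x ∉ d ∧ RankDominant k (insert x d)) = {x, y} := by
      ext z
      rw [Finset.mem_filter, rankDominant_insert_iff hk hd hm hmin hsurj hab hmab hdom,
        Finset.mem_insert, Finset.mem_singleton]
      simp only [Finset.mem_univ, true_and]
      constructor
      · rintro (h | h)
        · exact Or.inl (hk a (le_antisymm (hx.2 z h.1) (h.2 x hx.1)))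
        · exact Or.inr (hk b (le_antisymm (hy.2 z h.1) (h.2 y hy.1)))
      · rintro (rfl | rfl)
        · exact Or.inl hx
        · exact Or.inr hy
    rw [this, Finset.card_pair]
    · exact even_two
    · rintro rfl
      obtain ⟨i, hi⟩ := hdom x
      by_cases hia : i = a
      · exact absurd (hi _ (hm i)) (not_le.mpr (hy.1 i (hia ▸ hab)))
      · exact absurd (hi _ (hm i)) (not_le.mpr (hx.1 i hia))

/-- Scarf's lemma on the integer points of a dilated simplex: for every colouring there is a point
`p` such that, for each `i`, either a nearby point has colour `i` or `p i` is small. -/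
theorem exists_integer_point_near_colours {I : Type*} [Fintype I] [DecidableEq I] [Nontrivial I]
    (N : ℕ) (c : (I → ℕ) → I) :
    ∃ p : I → ℕ, ∑ i, p i = N ∧ ∀ i,
      (∃ x : I → ℕ, ∑ j, x j = N ∧ c x = i ∧ ∀ j, p j ≤ x j + Fintype.card I ∧
        x j ≤ p j + Fintype.card I) ∨ p i ≤ Fintype.card I := by
  classical
  obtain ⟨i₀⟩ : Nonempty I := inferInstance
  let T := {x : I → Fin (N + 1) // ∑ i, (x i : ℕ) = N}
  have hT : ∀ y : I → ℕ, ∑ i, y i = N → ∃ t : T, ∀ i, ((t.1 i : Fin (N + 1)) : ℕ) = y i := by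
    intro y hy
    have hle : ∀ i, y i < N + 1 := fun i => by
      have := Finset.single_le_sum (f := y) (fun _ _ => Nat.zero_le _) (Finset.mem_univ i)
      omega
    exact ⟨⟨fun i => ⟨y i, hle i⟩, hy⟩, fun i => rfl⟩
  set M := Fintype.card T with hM
  let e : T ≃ Fin M := Fintype.equivFin T
  have hkey : ∀ (x y : T) (i : I), (x.1 i : ℕ) * M + e x ≤ (y.1 i : ℕ) * M + e y →
      (x.1 i : ℕ) ≤ y.1 i := by
    intro x y i h
    by_contra! hlt
    have h1 : ((y.1 i : ℕ) + 1) * M ≤ (x.1 i : ℕ) * M := Nat.mul_le_mul_right _ hlt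
    have h2 := (e y).2
    nlinarith
  have hbound : ∀ (x : T) (i : I), (x.1 i : ℕ) * M + e x < (N + 1) * M := by
    intro x i
    have h1 : ((x.1 i : ℕ) + 1) * M ≤ (N + 1) * M := Nat.mul_le_mul_right _ (x.1 i).2
    have h2 := (e x).2
    nlinarith
  -- Grid points are ranked by their `i`-th coordinate, ties being broken by the enumeration `e`;
  -- the slack of `i` gets 0 and all other slacks lie above the grid.
  let k : I → T ⊕ I → ℕ := fun i => Sum.elim (fun x => 1 + ((x.1 i : ℕ) * M + e x))
    (fun j => if j = i then 0 else 1 + (N + 1) * M + Fintype.equivFin I j)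
  have hk : ∀ i, Function.Injective (k i) := by
    rintro i (x | j) (y | l) h
    · simp only [k, Sum.elim_inl] at h
      have h1 : (x.1 i : ℕ) = y.1 i :=
        le_antisymm (hkey x y i (by omega)) (hkey y x i (by omega))
      rw [h1] at h
      have : e x = e y := Fin.ext (by omega)
      rw [e.injective this]
    · simp only [k, Sum.elim_inl, Sum.elim_inr] at h
      have := hbound x i
      split_ifs at h <;> omega
    · simp only [k, Sum.elim_inl, Sum.elim_inr] at h
      have := hbound y i
      split_ifs at h <;> omega
    · simp only [k, Sum.elim_inr] at h
      split_ifs at h with h1 h2 h2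
      · rw [h1, h2]
      · omega
      · omega
      · have : Fintype.equivFin I j = Fintype.equivFin I l := Fin.ext (by omega)
        rw [(Fintype.equivFin I).injective this]
  obtain ⟨S, hScard, hSdom, hScol⟩ := exists_rankDominant_image_eq_univ hk (Sum.inr : I → T ⊕ I)
    Sum.inr_injective
    (by
      rintro i (x | j) hv
      · simp [k]
      · have : j ≠ i := fun h => hv (by rw [h])
        simp only [k, Sum.elim_inr, if_true, if_neg this]; omega)
    (by
      rintro i j (x | l) hji hv
      · simp only [k, Sum.elim_inl, Sum.elim_inr, if_neg hji]
        have := hbound x i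
        omega
      · exact absurd ⟨l, rfl⟩ hv)
    (Sum.elim (fun x => c fun i => (x.1 i : ℕ)) id) (fun i => rfl)
  -- domination of a grid point
  have hdom : ∀ y : T, ∃ i, Sum.inr i ∉ S ∧ ∀ x : T, Sum.inl x ∈ S → (y.1 i : ℕ) ≤ x.1 i := by
    intro y
    obtain ⟨i, hi⟩ := hSdom (Sum.inl y)
    refine ⟨i, fun h => ?_, fun x hx => hkey y x i ?_⟩
    · have := hi _ h
      simp [k] at this
    · have := hi _ hx
      simp only [k, Sum.elim_inl] at this
      omega
  obtain ⟨p, hp⟩ : ∃ p : T, Sum.inl p ∈ S := by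
    by_contra! hcon
    have hall : ∀ i, Sum.inr i ∈ S := by
      intro i
      have : i ∈ S.image (Sum.elim (fun x : T => c fun i => (x.1 i : ℕ)) id) := by
        rw [hScol]; exact Finset.mem_univ _
      obtain ⟨v, hv, hvi⟩ := Finset.mem_image.mp this
      rcases v with x | j
      · exact absurd hv (hcon x)
      · simp only [Sum.elim_inr, id] at hvi
        exact hvi ▸ hv
    obtain ⟨t, -⟩ := hT (fun i => if i = i₀ then N else 0) (by simp)
    obtain ⟨i, hi, -⟩ := hdom t
    exact hi (hall i)
  set σ : Finset T := Finset.univ.filter fun x => Sum.inl x ∈ S with hσ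
  set C : Finset I := Finset.univ.filter fun i => Sum.inr i ∉ S with hC
  have hσne : σ.Nonempty := ⟨p, by simp [hσ, hp]⟩
  choose q hq hqmin using fun i => Finset.exists_min_image σ (fun x : T => (x.1 i : ℕ)) hσne
  -- Otherwise raising every minimum over `C` by one, with the remainder put into coordinate `i₁`,
  -- gives a grid point that no ranking places below all of `S`. The bound leaves the points of `σ`
  -- a total slack below `card I`, hence the closeness estimates.
  have hsum : N < ∑ i ∈ C, (((q i).1 i : ℕ) + 1) := by
    by_contra! hle
    have hCne : C.Nonempty := by
      obtain ⟨i, hi, -⟩ := hdom p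
      exact ⟨i, by simp [hC, hi]⟩
    obtain ⟨i₁, hi₁⟩ := hCne
    let y : I → ℕ := fun i => (if i ∈ C then ((q i).1 i : ℕ) + 1 else 0) +
      if i = i₁ then N - ∑ i ∈ C, (((q i).1 i : ℕ) + 1) else 0
    obtain ⟨t, ht⟩ := hT y (by
      simp only [y, Finset.sum_add_distrib, Finset.sum_ite_mem, Finset.univ_inter,
        Finset.sum_ite_eq', Finset.mem_univ, if_true]
      rw [← Finset.sum_add_distrib]
      omega)
    obtain ⟨i, hi, hmin⟩ := hdom t
    have hiC : i ∈ C := by simp [hC, hi]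
    have := hmin (q i) (by simpa [hσ] using hq i)
    rw [ht] at this
    simp only [y, if_pos hiC] at this
    omega
  rw [Finset.sum_add_distrib, Finset.sum_const, smul_eq_mul, mul_one] at hsum
  have hCcard : C.card ≤ Fintype.card I := Finset.card_le_univ C
  have hsplit : ∀ x : T, ∑ i ∈ C, (x.1 i : ℕ) + ∑ i ∈ Cᶜ, (x.1 i : ℕ) = N := fun x => by
    rw [Finset.sum_add_sum_compl, x.2]
  have hout : ∀ x ∈ σ, ∀ i ∉ C, (x.1 i : ℕ) ≤ Fintype.card I := by
    intro x hx i hi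
    have h1 : ∑ j ∈ C, ((q j).1 j : ℕ) ≤ ∑ j ∈ C, (x.1 j : ℕ) :=
      Finset.sum_le_sum fun j _ => hqmin j x hx
    have h2 := Finset.single_le_sum (f := fun j => (x.1 j : ℕ)) (fun _ _ => Nat.zero_le _)
      (Finset.mem_compl.mpr hi)
    have h3 := hsplit x
    omega
  have hin : ∀ x ∈ σ, ∀ i ∈ C, (x.1 i : ℕ) ≤ (q i).1 i + Fintype.card I := by
    intro x hx i hi
    have h1 : ∑ j ∈ C.erase i, ((q j).1 j : ℕ) ≤ ∑ j ∈ C.erase i, (x.1 j : ℕ) :=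
      Finset.sum_le_sum fun j _ => hqmin j x hx
    have h2 := Finset.add_sum_erase C (fun j => (x.1 j : ℕ)) hi
    have h3 := Finset.add_sum_erase C (fun j => ((q j).1 j : ℕ)) hi
    have h4 := hsplit x
    omega
  have hclose : ∀ x ∈ σ, ∀ y ∈ σ, ∀ i, (x.1 i : ℕ) ≤ y.1 i + Fintype.card I := by
    intro x hx y hy i
    by_cases hi : i ∈ C
    · exact (hin x hx i hi).trans (Nat.add_le_add_right (hqmin i y hy) _)
    · exact (hout x hx i hi).trans (Nat.le_add_left _ _)
  have hpσ : p ∈ σ := by simp [hσ, hp]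
  refine ⟨fun i => (p.1 i : ℕ), p.2, fun i => ?_⟩
  by_cases hi : i ∈ C
  · left
    have : i ∈ S.image (Sum.elim (fun x : T => c fun i => (x.1 i : ℕ)) id) := by
      rw [hScol]; exact Finset.mem_univ _
    obtain ⟨v, hv, hvi⟩ := Finset.mem_image.mp this
    rcases v with x | j
    · have hxσ : x ∈ σ := by simp [hσ, hv]
      exact ⟨fun j => (x.1 j : ℕ), x.2, hvi, fun j => ⟨hclose p hpσ x hxσ j, hclose x hxσ p hpσ j⟩⟩
    · simp only [Sum.elim_inr, id] at hvi
      subst hvi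
      simp [hC, hv] at hi
  · exact Or.inr (hout p hpσ i hi)

/-! ### Brouwer's fixed point theorem. -/

/-- **Brouwer's fixed point theorem** for the standard simplex. -/
theorem exists_fixedPoint_stdSimplex {I : Type*} [Fintype I] [Nonempty I]
    (f : (I → ℝ) → I → ℝ) (hf : ContinuousOn f (stdSimplex ℝ I))
    (hmaps : MapsTo f (stdSimplex ℝ I) (stdSimplex ℝ I)) :
    ∃ x ∈ stdSimplex ℝ I, f x = x := by
  classical
  have hne : (stdSimplex ℝ I).Nonempty := by
    obtain ⟨i⟩ := ‹Nonempty I›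
    exact ⟨_, single_mem_stdSimplex ℝ i⟩
  have hcompact : IsCompact (stdSimplex ℝ I) := isCompact_stdSimplex ℝ I
  rcases subsingleton_or_nontrivial I with hI | hI
  · obtain ⟨x, hx⟩ := hne
    refine ⟨x, hx, ?_⟩
    ext i
    have h1 := hx.2
    have h2 := (hmaps hx).2
    rw [Fintype.sum_subsingleton _ i] at h1 h2
    rw [h1, h2]
  -- approximate fixed points
  have happrox : ∀ ε > 0, ∃ p ∈ stdSimplex ℝ I, ∀ i, p i - f p i ≤ ε := by
    intro ε hε
    have huc := hcompact.uniformContinuousOn_of_continuous hf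
    rw [Metric.uniformContinuousOn_iff] at huc
    obtain ⟨δ, hδ, hfδ⟩ := huc (ε / 2) (half_pos hε)
    obtain ⟨N, hN⟩ := exists_nat_gt (Fintype.card I / min δ (ε / 2))
    have hmin : 0 < min δ (ε / 2) := lt_min hδ (half_pos hε)
    have hcardpos : (0 : ℝ) < Fintype.card I := by exact_mod_cast Fintype.card_pos
    have hNpos : (0 : ℝ) < N := (div_pos hcardpos hmin).trans hN
    have hsmall : (Fintype.card I : ℝ) / N < min δ (ε / 2) := by
      rw [div_lt_iff₀ hmin] at hN
      rw [div_lt_iff₀ hNpos]; linarith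
    let g : (I → ℕ) → I → ℝ := fun x i => (x i : ℝ) / N
    have hg : ∀ x : I → ℕ, ∑ i, x i = N → g x ∈ stdSimplex ℝ I := by
      intro x hx
      refine ⟨fun i => by positivity, ?_⟩
      simp only [g]
      rw [← Finset.sum_div, ← Nat.cast_sum, hx, div_self hNpos.ne']
    -- Colour a grid point by a coordinate that `f` does not decrease; the sums being equal, there
    -- is one.
    have hcol : ∀ x : I → ℕ, ∃ i, ∑ j, x j = N → g x i ≤ f (g x) i := by
      intro x
      by_cases hx : ∑ j, x j = N
      · by_contra! hcon
        have h1 := (hg x hx).2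
        have h2 := (hmaps (hg x hx)).2
        have := Finset.sum_lt_sum_of_nonempty (s := Finset.univ) Finset.univ_nonempty
          (fun i _ => (hcon i).2)
        linarith
      · exact ⟨Classical.arbitrary I, fun h => absurd h hx⟩
    choose c hc using hcol
    obtain ⟨p, hp, hpi⟩ := exists_integer_point_near_colours N c
    refine ⟨g p, hg p hp, fun i => ?_⟩
    rcases hpi i with ⟨x, hx, hcx, hclose⟩ | hle
    · have hcl : ∀ j, |g x j - g p j| ≤ Fintype.card I / N := by
        intro j
        obtain ⟨h1, h2⟩ := hclose j
        have h1' : (p j : ℝ) ≤ x j + Fintype.card I := by exact_mod_cast h1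
        have h2' : (x j : ℝ) ≤ p j + Fintype.card I := by exact_mod_cast h2
        simp only [g]
        rw [← sub_div, abs_div, abs_of_pos hNpos]
        gcongr
        rw [abs_le]; constructor <;> linarith
      have hdist : dist (g x) (g p) < δ := by
        refine (dist_pi_lt_iff hδ).mpr fun j => ?_
        rw [Real.dist_eq]
        exact (hcl j).trans_lt (hsmall.trans_le (min_le_left _ _))
      have h3 := hfδ _ (hg x hx) _ (hg p hp) hdist
      have h4 := (dist_le_pi_dist (f (g x)) (f (g p)) i).trans_lt h3
      rw [Real.dist_eq, abs_lt] at h4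
      have h5 := hc x hx
      rw [hcx] at h5
      have h6 := (abs_le.mp (hcl i)).1
      have h7 := hsmall.trans_le (min_le_right _ _)
      linarith [h4.2]
    · have h1 : g p i ≤ Fintype.card I / N := by
        simp only [g]
        gcongr
      have h2 := (hmaps (hg p hp)).1 i
      have h7 := hsmall.trans_le (min_le_right _ _)
      linarith
  have hGc : ContinuousOn (fun p => ∑ i, max (p i - f p i) 0) (stdSimplex ℝ I) := by
    refine continuousOn_finsetSum _ fun i _ => ContinuousOn.sup (ContinuousOn.sub
      (continuous_apply i).continuousOn ((continuous_apply i).comp_continuousOn hf))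
      continuousOn_const
  obtain ⟨x, hx, hmin⟩ := hcompact.exists_isMinOn hne hGc
  have hcardpos : (0 : ℝ) < Fintype.card I := by exact_mod_cast Fintype.card_pos
  have hzero : ∑ i, max (x i - f x i) 0 ≤ 0 := by
    refine le_of_forall_pos_le_add fun ε hε => ?_
    obtain ⟨p, hp, hpi⟩ := happrox (ε / Fintype.card I) (by positivity)
    have h1 : ∑ i, max (x i - f x i) 0 ≤ ∑ i, max (p i - f p i) 0 := hmin hp
    have h2 : ∑ i, max (p i - f p i) 0 ≤ ∑ _i : I, ε / Fintype.card I :=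
      Finset.sum_le_sum fun i _ => max_le (hpi i) (by positivity)
    rw [Finset.sum_const, Finset.card_univ, nsmul_eq_mul, mul_div_cancel₀ _ hcardpos.ne'] at h2
    linarith
  have hle : ∀ i ∈ Finset.univ, x i ≤ f x i := by
    intro i hi
    have := Finset.single_le_sum (f := fun i => max (x i - f x i) 0)
      (fun _ _ => le_max_right _ _) hi
    have := le_max_left (x i - f x i) 0
    linarith
  have heq := (Finset.sum_eq_sum_iff_of_le hle).mp (by rw [hx.2, (hmaps hx).2])
  exact ⟨x, hx, funext fun i => (heq i (Finset.mem_univ _)).symm⟩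

/-! ### Pure Nash equilibria under quasiconvexity. -/

theorem update_mem_univ_pi {ι : Type*} [DecidableEq ι] {E : ι → Type*} {A : ∀ j, Set (E j)}
    {a : ∀ j, E j} (ha : a ∈ univ.pi A) {j : ι} {b : E j} (hb : b ∈ A j) :
    Function.update a j b ∈ univ.pi A := by
  intro k _
  by_cases hk : k = j
  · subst hk; simpa using hb
  · simpa [hk] using ha k (mem_univ k)

/-- Approximate equilibria of a game with quasiconvex costs, against finitely many deviations. -/
theorem exists_approx_equilibrium_finset {ι : Type*} [Fintype ι] [DecidableEq ι] {E : ι → Type*}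
    [∀ j, AddCommGroup (E j)] [∀ j, Module ℝ (E j)] [∀ j, TopologicalSpace (E j)]
    [∀ j, ContinuousAdd (E j)] [∀ j, ContinuousSMul ℝ (E j)]
    {A : ∀ j, Set (E j)} (hconvex : ∀ j, Convex ℝ (A j)) {u : ι → (∀ j, E j) → ℝ}
    (hu : ∀ j, ContinuousOn (u j) (univ.pi A))
    (hq : ∀ j, ∀ a ∈ univ.pi A, QuasiconvexOn ℝ (A j) fun x => u j (Function.update a j x))
    (B : ∀ j, Finset (E j)) (hB : ∀ j, (B j).Nonempty) (hBA : ∀ j, ∀ b ∈ B j, b ∈ A j)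
    {ε : ℝ} (hε : 0 < ε) :
    ∃ a ∈ univ.pi A, ∀ j, ∀ b ∈ B j, u j a ≤ u j (Function.update a j b) + ε := by
  have : ∀ j, Nonempty (B j) := fun j => (hB j).to_subtype
  -- A single simplex, spanned by the tuples of deviations, serves all players at once, so that
  -- Brouwer's theorem applies directly.
  let P : ((∀ j, B j) → ℝ) → ∀ j, E j := fun t j => ∑ b, t b • ((b j : B j) : E j)
  have hP : MapsTo P (stdSimplex ℝ (∀ j, B j)) (univ.pi A) := fun t ht j _ =>
    (hconvex j).sum_mem (fun b _ => ht.1 b) ht.2 fun b _ => hBA j _ (b j).2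
  have hPc : Continuous P := by
    refine continuous_pi fun j => ?_
    simp only [P]
    fun_prop
  let v : ι → (∀ j, E j) → ℝ := fun j a => (B j).inf' (hB j) fun b => u j (Function.update a j b)
  have huc : ∀ j, ∀ b ∈ B j, ContinuousOn (fun a => u j (Function.update a j b)) (univ.pi A) :=
    fun j b hb => (hu j).comp (continuous_id.update j continuous_const).continuousOn
      fun a ha => update_mem_univ_pi ha (hBA j b hb)
  have hvc : ∀ j, ContinuousOn (v j) (univ.pi A) := fun j =>
    ContinuousOn.finset_inf'_apply (hB j) fun b hb => huc j b hb
  -- The weight of a tuple is positive exactly when each of its components is within `ε` of the best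
  -- deviation in `B j`.
  let φ : (∀ j, B j) → (∀ j, E j) → ℝ := fun b a =>
    ∏ j, max 0 (ε - (u j (Function.update a j (b j)) - v j a))
  have hφc : ∀ b, ContinuousOn (φ b) (univ.pi A) := fun b =>
    continuousOn_finsetProd _ fun j _ => continuousOn_const.sup
      (continuousOn_const.sub ((huc j _ (b j).2).sub (hvc j)))
  have hφ0 : ∀ b a, 0 ≤ φ b a := fun b a => Finset.prod_nonneg fun j _ => le_max_left _ _
  have hφpos : ∀ a, 0 < ∑ b, φ b a := by
    intro a
    choose b hb hbv using fun j => Finset.exists_mem_eq_inf' (hB j)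
      fun b => u j (Function.update a j b)
    refine Finset.sum_pos' (fun b _ => hφ0 b a) ⟨fun j => ⟨b j, hb j⟩, Finset.mem_univ _, ?_⟩
    refine Finset.prod_pos fun j _ => lt_max_of_lt_right ?_
    have : v j a = u j (Function.update a j (b j)) := hbv j
    simp only
    linarith
  let F : ((∀ j, B j) → ℝ) → (∀ j, B j) → ℝ := fun t b => φ b (P t) / ∑ b', φ b' (P t)
  have hFc : ContinuousOn F (stdSimplex ℝ (∀ j, B j)) := by
    refine continuousOn_pi.mpr fun b => ContinuousOn.div ((hφc b).comp hPc.continuousOn hP)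
      ((continuousOn_finsetSum _ fun b' _ => hφc b').comp hPc.continuousOn hP)
      fun t _ => (hφpos _).ne'
  have hFm : MapsTo F (stdSimplex ℝ (∀ j, B j)) (stdSimplex ℝ (∀ j, B j)) := by
    intro t _
    refine ⟨fun b => div_nonneg (hφ0 _ _) (hφpos _).le, ?_⟩
    simp only [F]
    rw [← Finset.sum_div, div_self (hφpos _).ne']
  obtain ⟨t, ht, hFt⟩ := exists_fixedPoint_stdSimplex F hFc hFm
  refine ⟨P t, hP ht, fun j b hb => ?_⟩
  obtain ⟨b₀, hb₀, hb₀v⟩ := Finset.exists_mem_eq_inf' (hB j)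
    fun b => u j (Function.update (P t) j b)
  have hlevel := hq j (P t) (hP ht) (v j (P t) + ε)
  -- At the fixed point every tuple of positive weight consists of nearly best replies, and those of
  -- zero weight may be replaced by the best reply `b₀`. The combination then lies in a convex
  -- sublevel set.
  have hmem : ∑ b, t b • (if t b = 0 then b₀ else ((b j : B j) : E j)) ∈
      {x ∈ A j | u j (Function.update (P t) j x) ≤ v j (P t) + ε} := by
    refine hlevel.sum_mem (fun b _ => ht.1 b) ht.2 fun b _ => ?_
    split_ifs with h0
    · refine ⟨hBA j _ hb₀, ?_⟩
      have : v j (P t) = u j (Function.update (P t) j b₀) := hb₀v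
      linarith
    · refine ⟨hBA j _ (b j).2, ?_⟩
      have hne : φ b (P t) ≠ 0 := by
        intro h
        apply h0
        rw [← congrFun hFt b]
        simp only [F, h, zero_div]
      have hfac := (Finset.prod_ne_zero_iff.mp hne) j (Finset.mem_univ j)
      have hpos : 0 < ε - (u j (Function.update (P t) j (b j)) - v j (P t)) := by
        by_contra! hle
        exact hfac (max_eq_left hle)
      linarith
  have hPj : ∑ b, t b • (if t b = 0 then b₀ else ((b j : B j) : E j)) = P t j := by
    refine Finset.sum_congr rfl fun b _ => ?_
    split_ifs with h0
    · rw [h0, zero_smul, zero_smul]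
    · rfl
  rw [hPj] at hmem
  have h1 := hmem.2
  rw [Function.update_eq_self] at h1
  have h2 : v j (P t) ≤ u j (Function.update (P t) j b) := Finset.inf'_le _ hb
  linarith

/-- Existence of pure Nash equilibria for continuous costs, quasiconvex in the own action. -/
theorem exists_pure_equilibrium {ι : Type*} [Fintype ι] [DecidableEq ι] {E : ι → Type*}
    [∀ j, AddCommGroup (E j)] [∀ j, Module ℝ (E j)] [∀ j, TopologicalSpace (E j)]
    [∀ j, ContinuousAdd (E j)] [∀ j, ContinuousSMul ℝ (E j)]
    {A : ∀ j, Set (E j)} (hne : ∀ j, (A j).Nonempty) (hcompact : ∀ j, IsCompact (A j))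
    (hconvex : ∀ j, Convex ℝ (A j)) {u : ι → (∀ j, E j) → ℝ}
    (hu : ∀ j, ContinuousOn (u j) (univ.pi A))
    (hq : ∀ j, ∀ a ∈ univ.pi A, QuasiconvexOn ℝ (A j) fun x => u j (Function.update a j x)) :
    ∃ a ∈ univ.pi A, ∀ j, ∀ b ∈ A j, u j a ≤ u j (Function.update a j b) := by
  classical
  have : CompactSpace (univ.pi A) := isCompact_iff_compactSpace.mp (isCompact_univ_pi hcompact)
  -- One closed condition per player, deviation and tolerance; finitely many are met by an
  -- approximate equilibrium, and compactness meets them all.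
  let t : (Σ j, A j × ℕ) → Set (univ.pi A) := fun i =>
    {a | u i.1 a ≤ u i.1 (Function.update a i.1 i.2.1) + 1 / (i.2.2 + 1 : ℝ)}
  have htc : ∀ i, IsClosed (t i) := by
    rintro ⟨j, b, n⟩
    have h1 : Continuous fun a : univ.pi A => u j a :=
      (hu j).comp_continuous continuous_subtype_val fun a => a.2
    have h2 : Continuous fun a : univ.pi A => u j (Function.update a j b) :=
      (hu j).comp_continuous (continuous_subtype_val.update j continuous_const)
        fun a => update_mem_univ_pi a.2 b.2
    exact isClosed_le h1 (h2.add continuous_const)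
  obtain ⟨a, -, ha⟩ := isCompact_univ.inter_iInter_nonempty t htc (by
    intro s
    choose p hp using hne
    let B : ∀ j, Finset (E j) := fun j =>
      insert (p j) ((s.filter fun i => i.1 = j).image fun i =>
        if h : i.1 = j then h ▸ (i.2.1 : E i.1) else p j)
    have hBA : ∀ j, ∀ b ∈ B j, b ∈ A j := by
      intro j b hb
      rcases Finset.mem_insert.mp hb with rfl | hb
      · exact hp j
      · obtain ⟨i, hi, rfl⟩ := Finset.mem_image.mp hb
        obtain ⟨-, rfl⟩ := Finset.mem_filter.mp hi
        simp
    let N := s.sup fun i => i.2.2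
    obtain ⟨a, ha, hle⟩ := exists_approx_equilibrium_finset hconvex hu hq B
      (fun j => Finset.insert_nonempty _ _) hBA (ε := 1 / (N + 1 : ℝ)) (by positivity)
    refine ⟨⟨a, ha⟩, mem_univ _, mem_iInter₂.mpr fun i hi => ?_⟩
    have h1 := hle i.1 i.2.1 (Finset.mem_insert_of_mem (Finset.mem_image.mpr
      ⟨i, Finset.mem_filter.mpr ⟨hi, rfl⟩, by simp⟩))
    have h2 : i.2.2 ≤ N := Finset.le_sup (f := fun i : (Σ j, A j × ℕ) => i.2.2) hi
    have h3 : 1 / (N + 1 : ℝ) ≤ 1 / (i.2.2 + 1 : ℝ) := by gcongr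
    exact h1.trans (by linarith))
  refine ⟨a, a.2, fun j b hb => ?_⟩
  have h := fun n : ℕ => mem_iInter.mp ha ⟨j, ⟨b, hb⟩, n⟩
  refine le_of_forall_pos_lt_add fun ε hε => ?_
  obtain ⟨n, hn⟩ := exists_nat_one_div_lt hε
  exact (h n).trans_lt (by simpa using hn)

/-! ### Scalar Lagrange multipliers. -/

/-- A Lagrange multiplier for one scalar equality constraint. -/
theorem exists_multiplier_of_eq {K : Set (ℝ × ℝ)} (hK : Convex ℝ K) {V : ℝ}
    (h0 : ∀ u, (u, (0 : ℝ)) ∈ K → u ≤ V) (hpos : ∃ p ∈ K, 0 < p.2) (hneg : ∃ p ∈ K, p.2 < 0) :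
    ∃ μ : ℝ, ∀ p ∈ K, p.1 - μ * p.2 ≤ V := by
  obtain ⟨p₀, hp₀, hp₀'⟩ := hpos
  obtain ⟨q₀, hq₀, hq₀'⟩ := hneg
  -- The segment from `p` to `q` meets the axis, where `h0` applies; rearranged, this compares the
  -- two slopes. Any `μ` separating the slopes is a multiplier.
  have hcross : ∀ p ∈ K, 0 < p.2 → ∀ q ∈ K, q.2 < 0 →
      (p.1 - V) / p.2 ≤ (q.1 - V) / q.2 := by
    intro p hp hp2 q hq hq2
    have hden : 0 < p.2 - q.2 := by linarith
    have hmem := hK hp hq (a := -q.2 / (p.2 - q.2)) (b := p.2 / (p.2 - q.2))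
      (div_nonneg (by linarith) hden.le) (div_nonneg hp2.le hden.le) (by field_simp; ring)
    have h := h0 (-q.2 / (p.2 - q.2) * p.1 + p.2 / (p.2 - q.2) * q.1) (by
      convert hmem using 1
      ext
      · simp
      · simp only [Prod.snd_add, Prod.smul_snd, smul_eq_mul]; field_simp; ring)
    have h' : -q.2 * p.1 + p.2 * q.1 ≤ V * (p.2 - q.2) := by
      rw [← div_le_iff₀ hden]
      calc _ = _ := by ring
        _ ≤ V := h
    rw [div_le_iff₀ hp2, div_mul_eq_mul_div, le_div_iff_of_neg hq2]
    nlinarith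
  obtain ⟨μ, h1, h2⟩ := exists_between_of_forall_le
    (s := {x | ∃ p ∈ K, 0 < p.2 ∧ x = (p.1 - V) / p.2})
    (t := {x | ∃ q ∈ K, q.2 < 0 ∧ x = (q.1 - V) / q.2})
    ⟨_, p₀, hp₀, hp₀', rfl⟩ ⟨_, q₀, hq₀, hq₀', rfl⟩ (by
      rintro _ ⟨p, hp, hp2, rfl⟩ _ ⟨q, hq, hq2, rfl⟩
      exact hcross p hp hp2 q hq hq2)
  refine ⟨μ, fun p hp => ?_⟩
  rcases lt_trichotomy p.2 0 with h | h | h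
  · have := h2 ⟨p, hp, h, rfl⟩
    rw [le_div_iff_of_neg h] at this
    linarith
  · have := h0 p.1 (by rw [← h]; exact hp)
    rw [h]; linarith
  · have := h1 ⟨p, hp, h, rfl⟩
    rw [div_le_iff₀ h] at this
    linarith

/-- A Lagrange multiplier for one scalar inequality constraint, under Slater's condition. -/
theorem exists_multiplier_of_le {K : Set (ℝ × ℝ)} (hK : Convex ℝ K) {V : ℝ}
    (h0 : ∀ p ∈ K, p.2 ≤ 0 → p.1 ≤ V) (hneg : ∃ p ∈ K, p.2 < 0) :
    ∃ lam : ℝ, 0 ≤ lam ∧ ∀ p ∈ K, p.1 - lam * p.2 ≤ V := by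
  by_cases hpos : ∃ p ∈ K, 0 < p.2
  · obtain ⟨μ, hμ⟩ := exists_multiplier_of_eq hK (fun u hu => h0 _ hu le_rfl) hpos hneg
    -- Replacing a negative `μ` by 0 is harmless: it lowers the left side where `p.2 ≥ 0`, and `h0`
    -- covers the rest.
    refine ⟨max μ 0, le_max_right _ _, fun p hp => ?_⟩
    have h1 := hμ p hp
    rcases le_total p.2 0 with h | h
    · rcases max_choice μ 0 with h' | h' <;> rw [h']
      · exact h1
      · simpa using h0 p hp h
    · have := mul_le_mul_of_nonneg_right (le_max_left μ 0) h
      linarith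
  · push Not at hpos
    exact ⟨0, le_rfl, fun p hp => by simpa using h0 p hp (hpos p hp)⟩

/-! ### Convex analysis of divergence generators. -/

/-- The real epigraph of an extended-real-valued function. -/
def realEpigraph (f : ℝ → EReal) : Set (ℝ × ℝ) := {p | f p.1 ≤ (p.2 : EReal)}

namespace IsDivergenceGenerator

theorem convex_realEpigraph {f : ℝ → EReal} (hf : IsDivergenceGenerator f) :
    Convex ℝ (realEpigraph f) := hf.convex_epigraph

theorem coe_toReal {f : ℝ → EReal} (hf : IsDivergenceGenerator f) {x : ℝ} (hx : f x ≠ ⊤) : ((f x).toReal : EReal) = f x :=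
  EReal.coe_toReal hx (hf.ne_bot x)

theorem mem_realEpigraph {f : ℝ → EReal} (hf : IsDivergenceGenerator f) {x : ℝ} (hx : f x ≠ ⊤) : (x, (f x).toReal) ∈ realEpigraph f :=
  (hf.coe_toReal hx).ge

theorem toReal_le {f : ℝ → EReal} (hf : IsDivergenceGenerator f) {p : ℝ × ℝ} (hp : p ∈ realEpigraph f) : (f p.1).toReal ≤ p.2 := by
  have hp' : f p.1 ≤ (p.2 : EReal) := hp
  have hne : f p.1 ≠ ⊤ := (hp'.trans_lt (EReal.coe_lt_top _)).ne
  rw [← hf.coe_toReal hne] at hp'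
  exact_mod_cast hp'

theorem one_ne_top {f : ℝ → EReal} (hf : IsDivergenceGenerator f) : f 1 ≠ ⊤ := interior_subset hf.finite_near_one

theorem exists_near_one {f : ℝ → EReal} (hf : IsDivergenceGenerator f) : ∃ δ > 0, f (1 - δ) ≠ ⊤ ∧ f (1 + δ) ≠ ⊤ := by
  obtain ⟨ε, hε, hsub⟩ := Metric.isOpen_iff.mp isOpen_interior 1 hf.finite_near_one
  refine ⟨ε / 2, half_pos hε, interior_subset (hsub ?_), interior_subset (hsub ?_)⟩ <;>
    (rw [Metric.mem_ball, Real.dist_eq, abs_lt]; constructor <;> linarith)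

theorem nonneg_of_ne_top {f : ℝ → EReal} (hf : IsDivergenceGenerator f) {x : ℝ}
    (hx : f x ≠ ⊤) : 0 ≤ x := by
  by_contra! h
  exact hx (hf.eq_top_of_neg x h)

theorem nonneg_of_mem {f : ℝ → EReal} (hf : IsDivergenceGenerator f) {p : ℝ × ℝ}
    (hp : p ∈ realEpigraph f) : 0 ≤ p.1 :=
  hf.nonneg_of_ne_top ((show f p.1 ≤ (p.2 : EReal) from hp).trans_lt (EReal.coe_lt_top _)).ne

/-- Subgradients exist strictly inside the domain. -/
theorem exists_subgradient {f : ℝ → EReal} (hf : IsDivergenceGenerator f) {x a b : ℝ}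
    (ha : f a ≠ ⊤) (hb : f b ≠ ⊤) (hax : a < x)
    (hxb : x < b) : ∃ s : ℝ, ∀ p ∈ realEpigraph f, (f x).toReal + s * (p.1 - x) ≤ p.2 := by
  -- In these coordinates one maximises minus the height subject to zero offset from `x`; the
  -- multiplier is minus the subgradient.
  have hK : Convex ℝ {q : ℝ × ℝ | (q.2 + x, -q.1) ∈ realEpigraph f} := by
    intro p hp q hq α β hα hβ hαβ
    have h1 : (α • (p.2 + x, -p.1) + β • (q.2 + x, -q.1) : ℝ × ℝ) =
        ((α • p + β • q).2 + x, -(α • p + β • q).1) := by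
      ext
      · simp; linear_combination x * hαβ
      · simp; ring
    have := hf.convex_realEpigraph hp hq hα hβ hαβ
    rw [h1] at this
    exact this
  obtain ⟨μ, hμ⟩ := exists_multiplier_of_eq hK (V := -(f x).toReal)
    (fun u hu => by
      have := hf.toReal_le (p := (0 + x, -u)) hu
      simp only [zero_add] at this
      linarith)
    ⟨(-(f b).toReal, b - x), by simpa using hf.mem_realEpigraph hb, by simpa using hxb⟩
    ⟨(-(f a).toReal, a - x), by simpa using hf.mem_realEpigraph ha, by simpa using hax⟩
  refine ⟨-μ, fun p hp => ?_⟩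
  have := hμ (-p.2, p.1 - x) (by simpa using hp)
  simp only at this
  linarith

theorem exists_subgradient_one {f : ℝ → EReal} (hf : IsDivergenceGenerator f) :
    ∃ s : ℝ, ∀ p ∈ realEpigraph f, (f 1).toReal + s * (p.1 - 1) ≤ p.2 := by
  obtain ⟨δ, hδ, h1, h2⟩ := hf.exists_near_one
  exact hf.exists_subgradient h1 h2 (by linarith) (by linarith)

theorem ne_top_of_mem_Icc {f : ℝ → EReal} (hf : IsDivergenceGenerator f) {a b x : ℝ}
    (ha : f a ≠ ⊤) (hb : f b ≠ ⊤) (hx : x ∈ Icc a b) :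
    f x ≠ ⊤ := by
  rw [← segment_eq_Icc (hx.1.trans hx.2)] at hx
  obtain ⟨α, β, hα, hβ, hαβ, rfl⟩ := hx
  have h : f _ ≤ _ := hf.convex_realEpigraph (hf.mem_realEpigraph ha) (hf.mem_realEpigraph hb)
    hα hβ hαβ
  exact (h.trans_lt (EReal.coe_lt_top _)).ne

/-- Sublevel sets of a convex function on the line are intervals. -/
protected theorem measurable {f : ℝ → EReal} (hf : IsDivergenceGenerator f) : Measurable f := by
  refine measurable_of_Iic fun c => OrdConnected.measurableSet (ordConnected_iff.mpr ?_)
  intro x hx y hy _ z hz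
  simp only [mem_preimage, mem_Iic] at hx hy ⊢
  induction c with
  | bot => exact absurd (le_bot_iff.mp hx) (hf.ne_bot x)
  | top => exact le_top
  | coe r =>
    rw [← segment_eq_Icc (hz.1.trans hz.2)] at hz
    obtain ⟨α, β, hα, hβ, hαβ, rfl⟩ := hz
    have h : f _ ≤ _ := hf.convex_realEpigraph (x := (x, r)) hx (y := (y, r)) hy hα hβ hαβ
    simp only [Prod.fst_add, Prod.smul_fst, Prod.snd_add, Prod.smul_snd, smul_eq_mul] at h ⊢
    rwa [← add_mul, hαβ, one_mul] at h

end IsDivergenceGenerator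

/-! ### Extended-real integrals. -/

section ExtIntegral

variable {Ω : Type*} [MeasurableSpace Ω] {m : Measure Ω}

theorem extIntegral_mono_ae {g h : Ω → EReal} (hgh : ∀ᵐ ω ∂m, g ω ≤ h ω) :
    extIntegral m g ≤ extIntegral m h := by
  refine EReal.sub_le_sub ?_ ?_
  · exact EReal.coe_ennreal_le_coe_ennreal_iff.mpr
      (lintegral_mono_ae (hgh.mono fun ω hω => EReal.toENNReal_le_toENNReal hω))
  · exact EReal.coe_ennreal_le_coe_ennreal_iff.mpr (lintegral_mono_ae
      (hgh.mono fun ω hω => EReal.toENNReal_le_toENNReal (EReal.neg_le_neg_iff.mpr hω)))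

theorem extIntegral_congr_ae {g h : Ω → EReal} (hgh : g =ᵐ[m] h) :
    extIntegral m g = extIntegral m h :=
  le_antisymm (extIntegral_mono_ae hgh.le) (extIntegral_mono_ae hgh.symm.le)

theorem lintegral_ofReal_ne_top {h : Ω → ℝ} (hh : Integrable h m) :
    ∫⁻ ω, ENNReal.ofReal (h ω) ∂m ≠ ⊤ :=
  (hh.lintegral_lt_top).ne

theorem lintegral_ofReal_neg_ne_top {h : Ω → ℝ} (hh : Integrable h m) :
    ∫⁻ ω, ENNReal.ofReal (-h ω) ∂m ≠ ⊤ :=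
  lintegral_ofReal_ne_top hh.neg

theorem extIntegral_coe {h : Ω → ℝ} (hh : Integrable h m) :
    extIntegral m (fun ω => (h ω : EReal)) = ((∫ ω, h ω ∂m : ℝ) : EReal) := by
  rw [integral_eq_lintegral_pos_part_sub_lintegral_neg_part hh, EReal.coe_sub,
    EReal.coe_ennreal_toReal (lintegral_ofReal_ne_top hh),
    EReal.coe_ennreal_toReal (lintegral_ofReal_neg_ne_top hh)]
  rfl

/-- Monotone convergence for `extIntegral`, as an upper bound. -/
theorem extIntegral_iSup_le {h : ℕ → Ω → ℝ} (hh : ∀ n, Integrable (h n) m)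
    (hmono : ∀ ω, Monotone fun n => h n ω) {c : ℝ} (hc : ∀ n, ∫ ω, h n ω ∂m ≤ c) :
    extIntegral m (fun ω => ⨆ n, (h n ω : EReal)) ≤ (c : EReal) := by
  have hlim : ∀ ω, Filter.Tendsto (fun n => (h n ω : EReal)) Filter.atTop
      (nhds (⨆ n, (h n ω : EReal))) := fun ω =>
    tendsto_atTop_iSup fun i j hij => EReal.coe_le_coe_iff.mpr (hmono ω hij)
  have h1 : Filter.Tendsto (fun n => ∫⁻ ω, ENNReal.ofReal (h n ω) ∂m) Filter.atTop
      (nhds (∫⁻ ω, (⨆ n, (h n ω : EReal)).toENNReal ∂m)) := by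
    refine lintegral_tendsto_of_tendsto_of_monotone (fun n => (hh n).aemeasurable.ennreal_ofReal)
      (.of_forall fun ω i j hij => ENNReal.ofReal_le_ofReal (hmono ω hij)) (.of_forall fun ω => ?_)
    exact (EReal.continuous_toENNReal.tendsto _).comp (hlim ω)
  have h2 : Filter.Tendsto (fun n => ∫⁻ ω, ENNReal.ofReal (-h n ω) ∂m) Filter.atTop
      (nhds (∫⁻ ω, (-(⨆ n, (h n ω : EReal))).toENNReal ∂m)) := by
    refine lintegral_tendsto_of_tendsto_of_antitone
      (fun n => (hh n).neg.aemeasurable.ennreal_ofReal)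
      (.of_forall fun ω i j hij => ENNReal.ofReal_le_ofReal (neg_le_neg (hmono ω hij)))
      (lintegral_ofReal_neg_ne_top (hh 0)) (.of_forall fun ω => ?_)
    exact (EReal.continuous_toENNReal.tendsto _).comp ((continuous_neg.tendsto _).comp (hlim ω))
  -- Keeping the negative part on the right avoids `∞ - ∞` in the limit; it is finite, being
  -- dominated by that of `h 0`.
  refine EReal.sub_le_of_le_add ?_
  refine le_of_tendsto_of_tendsto'
    ((continuous_coe_ennreal_ereal.tendsto _).comp h1)
    ((EReal.continuousAt_add (p := ((c : EReal), _)) (.inl (EReal.coe_ne_top c))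
      (.inl (EReal.coe_ne_bot c))).tendsto.comp (tendsto_const_nhds.prodMk_nhds
        ((continuous_coe_ennreal_ereal.tendsto _).comp h2))) fun n => ?_
  simp only [Function.comp_apply]
  have h3 := hc n
  rw [integral_eq_lintegral_pos_part_sub_lintegral_neg_part (hh n)] at h3
  rw [← EReal.coe_ennreal_toReal (lintegral_ofReal_ne_top (hh n)),
    ← EReal.coe_ennreal_toReal (lintegral_ofReal_neg_ne_top (hh n)), ← EReal.coe_add,
    EReal.coe_le_coe_iff]
  linarith

end ExtIntegral

/-! ### The reduced cost as a supremum of affine functions of the multipliers. -/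

section Representation

variable {Ω : Type*} [MeasurableSpace Ω] {m : Measure Ω} {f : ℝ → EReal}

/-- The Fenchel–Young inequality, scaled by `lam`. -/
theorem coe_le_mul_legendreFenchel {p : ℝ × ℝ} (hp : p ∈ realEpigraph f) {lam : ℝ}
    (hlam : 0 < lam) (y : ℝ) :
    ((p.1 * y - lam * p.2 : ℝ) : EReal) ≤ (lam : EReal) * legendreFenchel f (y / lam) := by
  have h1 : ((p.1 * (y / lam) - p.2 : ℝ) : EReal) ≤ legendreFenchel f (y / lam) := by
    refine le_iSup_of_le p.1 ?_
    rw [EReal.coe_sub]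
    exact EReal.sub_le_sub le_rfl hp
  have h2 : ((p.1 * y - lam * p.2 : ℝ) : EReal) =
      (lam : EReal) * ((p.1 * (y / lam) - p.2 : ℝ) : EReal) := by
    rw [← EReal.coe_mul]
    congr 1
    field_simp
  rw [h2]
  exact mul_le_mul_of_nonneg_left h1 (EReal.coe_nonneg.mpr hlam.le)

theorem mul_legendreFenchel_le (hf : IsDivergenceGenerator f) {lam : ℝ} (hlam : 0 < lam) (y : ℝ)
    {S : EReal} (hS : ∀ p ∈ realEpigraph f, ((p.1 * y - lam * p.2 : ℝ) : EReal) ≤ S) :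
    (lam : EReal) * legendreFenchel f (y / lam) ≤ S := by
  rw [mul_comm, ← EReal.le_div_iff_mul_le (EReal.coe_pos.mpr hlam) (EReal.coe_ne_top _)]
  refine iSup_le fun x => ?_
  rw [EReal.le_div_iff_mul_le (EReal.coe_pos.mpr hlam) (EReal.coe_ne_top _)]
  by_cases hx : f x = ⊤
  · rw [hx, sub_eq_add_neg, EReal.neg_top, EReal.add_bot, EReal.bot_mul_coe_of_pos hlam]
    exact bot_le
  · rw [← hf.coe_toReal hx, ← EReal.coe_sub, ← EReal.coe_mul]
    convert hS _ (hf.mem_realEpigraph hx) using 2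
    field_simp

/-- Running maxima of a jointly measurable objective along a sequence of candidates are attained by
simple functions. -/
theorem exists_simpleFunc_running_max {Z : Type*} [MeasurableSpace Z] (g : Ω → Z → ℝ)
    (hg : Measurable (Function.uncurry g)) (q : ℕ → Z) :
    ∃ s : ℕ → SimpleFunc Ω Z, (∀ n ω, ∃ k, s n ω = q k) ∧
      (∀ ω, Monotone fun n => g ω (s n ω)) ∧ ∀ n ω, g ω (q n) ≤ g ω (s n ω) := by
  classical
  have hmeas : ∀ s : SimpleFunc Ω Z, Measurable fun ω => g ω (s ω) := fun s =>
    hg.comp (measurable_id.prodMk s.measurable)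
  have hset : ∀ (s : SimpleFunc Ω Z) (z : Z), MeasurableSet {ω | g ω (s ω) < g ω z} := fun s z =>
    measurableSet_lt (hmeas s) (hmeas (SimpleFunc.const Ω z))
  let s : ℕ → SimpleFunc Ω Z := fun n => Nat.rec (SimpleFunc.const Ω (q 0))
    (fun n t => SimpleFunc.piecewise {ω | g ω (t ω) < g ω (q (n + 1))} (hset t _)
      (SimpleFunc.const Ω (q (n + 1))) t) n
  have hsucc : ∀ n ω, s (n + 1) ω = if g ω (s n ω) < g ω (q (n + 1)) then q (n + 1) else s n ω := by
    intro n ω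
    simp only [s, SimpleFunc.piecewise_apply, mem_ofPred_eq, SimpleFunc.const_apply]
  refine ⟨s, fun n ω => ?_, fun ω => monotone_nat_of_le_succ fun n => ?_, fun n ω => ?_⟩
  · induction n with
    | zero => exact ⟨0, rfl⟩
    | succ n ih =>
      rw [hsucc]
      split_ifs
      · exact ⟨n + 1, rfl⟩
      · exact ih
  · rw [hsucc]
    split_ifs with h
    · exact h.le
    · exact le_rfl
  · cases n with
    | zero => exact le_rfl
    | succ n =>
      rw [hsucc]
      split_ifs with h
      · exact le_rfl
      · exact not_lt.mp h

theorem SimpleFunc.integrable_fst_mul_sub [IsFiniteMeasure m] (s : SimpleFunc Ω (ℝ × ℝ))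
    {Y : Ω → ℝ} (hY : Integrable Y m) (lam : ℝ) :
    Integrable (fun ω => (s ω).1 * Y ω - lam * (s ω).2) m := by
  obtain ⟨C, hC⟩ := (s.map Prod.fst).exists_forall_norm_le
  have h1 : Integrable (fun ω => (s ω).1 * Y ω) m :=
    hY.bdd_mul (s.map Prod.fst).aestronglyMeasurable (.of_forall hC)
  have h2 : Integrable (fun ω => (s ω).2) m := (s.map Prod.snd).integrable_of_isFiniteMeasure
  exact h1.sub (h2.const_mul lam)

theorem reducedCost_congr_ae {X Y : Ω → ℝ} (h : X =ᵐ[m] Y) (f : ℝ → EReal) (ρ lam μ : ℝ) :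
    reducedCost f ρ m X lam μ = reducedCost f ρ m Y lam μ := by
  unfold reducedCost
  congr 1
  exact extIntegral_congr_ae (h.mono fun ω hω => by simp only [hω])

theorem reducedCost_eq (hf : IsDivergenceGenerator f) (ρ : ℝ) (X : Ω → ℝ) (lam μ : ℝ) :
    reducedCost f ρ m X lam μ = ((lam * (ρ + (f 1).toReal) + μ : ℝ) : EReal) +
      extIntegral m (fun ω => (lam : EReal) * legendreFenchel f ((X ω - μ) / lam)) := by
  unfold reducedCost
  rw [← hf.coe_toReal hf.one_ne_top]
  norm_cast

/-- Fenchel–Young integrated: `Z` plays the density and `R` an upper bound for `f ∘ Z`. Weak duality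
and coercivity both come from choices of this pair. -/
theorem le_reducedCost (hf : IsDivergenceGenerator f) {ρ : ℝ} {X : Ω → ℝ} {lam μ : ℝ}
    (hlam : 0 < lam) {Z R : Ω → ℝ} (hZR : ∀ᵐ ω ∂m, (Z ω, R ω) ∈ realEpigraph f)
    (hint : Integrable (fun ω => Z ω * (X ω - μ) - lam * R ω) m) :
    ((lam * (ρ + (f 1).toReal) + μ + ∫ ω, (Z ω * (X ω - μ) - lam * R ω) ∂m : ℝ) : EReal) ≤
      reducedCost f ρ m X lam μ := by
  rw [reducedCost_eq hf, EReal.coe_add]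
  refine add_le_add le_rfl ?_
  rw [← extIntegral_coe hint]
  exact extIntegral_mono_ae (hZR.mono fun ω hω => coe_le_mul_legendreFenchel hω hlam _)

/-- The reduced cost is the supremum of affine functions of the multipliers, indexed by the simple
functions with values in the epigraph. -/
theorem reducedCost_le_iff [IsFiniteMeasure m] (hf : IsDivergenceGenerator f) {ρ : ℝ} {X : Ω → ℝ}
    (hX : Integrable X m) {lam μ : ℝ} (hlam : 0 < lam) {c : ℝ} :
    reducedCost f ρ m X lam μ ≤ (c : EReal) ↔
      ∀ s : SimpleFunc Ω (ℝ × ℝ), (∀ ω, s ω ∈ realEpigraph f) →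
        lam * (ρ + (f 1).toReal) + μ + ∫ ω, ((s ω).1 * (X ω - μ) - lam * (s ω).2) ∂m ≤ c := by
  have hXμ : Integrable (fun ω => X ω - μ) m := hX.sub (integrable_const μ)
  constructor
  · intro h s hs
    exact_mod_cast (le_reducedCost hf hlam (.of_forall hs)
      (SimpleFunc.integrable_fst_mul_sub s hXμ lam)).trans h
  · intro h
    obtain ⟨Y, hYm, hXY⟩ := hX.aemeasurable
    rw [reducedCost_congr_ae hXY, reducedCost_eq hf]
    have hYμ : Integrable (fun ω => Y ω - μ) m := (hX.congr hXY).sub (integrable_const μ)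
    have : Nonempty (realEpigraph f) := ⟨⟨_, hf.mem_realEpigraph hf.one_ne_top⟩⟩
    -- For fixed `ω` the objective is continuous on the epigraph, so a dense sequence attains its
    -- supremum in the limit. Running maxima along it are simple and increasing, ready for monotone
    -- convergence.
    obtain ⟨q, hq⟩ := TopologicalSpace.exists_dense_seq (realEpigraph f)
    obtain ⟨s, hsq, hmono, hge⟩ := exists_simpleFunc_running_max
      (fun (ω : Ω) (p : ℝ × ℝ) => p.1 * (Y ω - μ) - lam * p.2)
      (by unfold Function.uncurry; fun_prop) (fun n => (q n : ℝ × ℝ))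
    have hsP : ∀ n ω, s n ω ∈ realEpigraph f := by
      intro n ω
      obtain ⟨k, hk⟩ := hsq n ω
      rw [hk]
      exact (q k).2
    have hsup : ∀ ω, (lam : EReal) * legendreFenchel f ((Y ω - μ) / lam) ≤
        ⨆ n, (((s n ω).1 * (Y ω - μ) - lam * (s n ω).2 : ℝ) : EReal) := by
      intro ω
      refine mul_legendreFenchel_le hf hlam _ fun p hp => ?_
      set S : EReal := ⨆ n, (((s n ω).1 * (Y ω - μ) - lam * (s n ω).2 : ℝ) : EReal)
      have hclosed : IsClosed {p : realEpigraph f |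
          ((p.1.1 * (Y ω - μ) - lam * p.1.2 : ℝ) : EReal) ≤ S} :=
        isClosed_le (continuous_coe_real_ereal.comp (by fun_prop)) continuous_const
      have hsub : range q ⊆ {p : realEpigraph f |
          ((p.1.1 * (Y ω - μ) - lam * p.1.2 : ℝ) : EReal) ≤ S} := by
        rintro _ ⟨n, rfl⟩
        exact (EReal.coe_le_coe_iff.mpr (hge n ω)).trans (le_iSup
          (fun n => (((s n ω).1 * (Y ω - μ) - lam * (s n ω).2 : ℝ) : EReal)) n)
      exact closure_minimal hsub hclosed (hq ⟨p, hp⟩)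
    have hle := (extIntegral_mono_ae (.of_forall hsup)).trans (extIntegral_iSup_le
      (fun n => SimpleFunc.integrable_fst_mul_sub (s n) hYμ lam) hmono
      (c := c - (lam * (ρ + (f 1).toReal) + μ)) fun n => by
        have h1 := h (s n) (hsP n)
        have h2 : ∫ ω, ((s n ω).1 * (X ω - μ) - lam * (s n ω).2) ∂m =
            ∫ ω, ((s n ω).1 * (Y ω - μ) - lam * (s n ω).2) ∂m :=
          integral_congr_ae (hXY.mono fun ω hω => by simp only [hω])
        rw [h2] at h1
        linarith)
    refine (add_le_add le_rfl hle).trans ?_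
    rw [← EReal.coe_add]
    exact EReal.coe_le_coe_iff.mpr (by linarith)

end Representation

/-! ### Weak and strong duality. -/

section Duality

variable {Ω : Type*} [MeasurableSpace Ω] {m : Measure Ω} {f : ℝ → EReal}

theorem integrable_lagrangian {X Z R : Ω → ℝ} (hZX : Integrable (fun ω => Z ω * X ω) m)
    (hZ : Integrable Z m) (hR : Integrable R m) (lam μ : ℝ) :
    Integrable (fun ω => Z ω * (X ω - μ) - lam * R ω) m := by
  refine ((hZX.sub (hZ.const_mul μ)).sub (hR.const_mul lam)).congr (.of_forall fun ω => ?_)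
  simp only [Pi.sub_apply]
  ring

theorem integral_lagrangian {X Z R : Ω → ℝ} (hZX : Integrable (fun ω => Z ω * X ω) m)
    (hZ : Integrable Z m) (hR : Integrable R m) (lam μ : ℝ) :
    ∫ ω, (Z ω * (X ω - μ) - lam * R ω) ∂m =
      ∫ ω, Z ω * X ω ∂m - μ * ∫ ω, Z ω ∂m - lam * ∫ ω, R ω ∂m := by
  have h : Integrable (fun ω => Z ω * X ω - μ * Z ω) m := hZX.sub (hZ.const_mul μ)
  rw [← integral_const_mul, ← integral_const_mul, ← integral_sub hZX (hZ.const_mul μ),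
    ← integral_sub h (hR.const_mul lam)]
  congr 1
  ext ω
  ring

theorem extIntegral_eq_integral_toReal {G : Ω → EReal} (hbot : ∀ ω, G ω ≠ ⊥)
    (htop : ∀ᵐ ω ∂m, G ω ≠ ⊤) (hint : Integrable (fun ω => (G ω).toReal) m) :
    extIntegral m G = ((∫ ω, (G ω).toReal ∂m : ℝ) : EReal) := by
  rw [← extIntegral_coe hint]
  exact extIntegral_congr_ae (htop.mono fun ω hω => (EReal.coe_toReal hω (hbot ω)).symm)

/-- A measurable function above an integrable one, with finite `extIntegral`, is integrable. -/
theorem integrable_toReal_of_extIntegral_lt_top {G : Ω → EReal} (hG : Measurable G)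
    {L : Ω → ℝ} (hL : Integrable L m) (hLG : ∀ᵐ ω ∂m, (L ω : EReal) ≤ G ω)
    (h : extIntegral m G < ⊤) :
    (∀ᵐ ω ∂m, G ω ≠ ⊤) ∧ Integrable (fun ω => (G ω).toReal) m := by
  have hneg : ∫⁻ ω, (-G ω).toENNReal ∂m ≠ ⊤ := by
    refine ((lintegral_mono_ae (hLG.mono fun ω hω => ?_)).trans_lt
      (lintegral_ofReal_neg_ne_top hL).lt_top).ne
    exact EReal.toENNReal_le_toENNReal (EReal.neg_le_neg_iff.mpr hω)
  have hpos : ∫⁻ ω, (G ω).toENNReal ∂m ≠ ⊤ := by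
    intro htop
    unfold extIntegral at h
    rw [htop, EReal.coe_ennreal_top, ← EReal.coe_ennreal_toReal hneg, EReal.top_sub_coe] at h
    exact lt_irrefl _ h
  have htop : ∀ᵐ ω ∂m, G ω ≠ ⊤ := (ae_lt_top' hG.ereal_toENNReal.aemeasurable hpos).mono
    fun ω hω h => hω.ne (EReal.toENNReal_eq_top_iff.mpr h)
  refine ⟨htop, hG.ereal_toReal.aestronglyMeasurable, ?_⟩
  have hsum : ∫⁻ ω, ((G ω).toENNReal + (-G ω).toENNReal) ∂m < ⊤ := by
    rw [lintegral_add_left hG.ereal_toENNReal]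
    exact ENNReal.add_lt_top.mpr ⟨hpos.lt_top, hneg.lt_top⟩
  refine (lintegral_mono_ae ?_).trans_lt hsum
  filter_upwards [htop, hLG] with ω h1 h2
  have h3 : G ω ≠ ⊥ := ((EReal.bot_lt_coe _).trans_le h2).ne'
  lift G ω to ℝ using ⟨h1, h3⟩ with x
  rw [EReal.toReal_coe, ← EReal.coe_neg, EReal.real_coe_toENNReal, EReal.real_coe_toENNReal,
    Real.enorm_eq_ofReal_abs]
  rcases abs_choice x with h | h <;> rw [h]
  · exact le_self_add
  · exact le_add_self

theorem fDivergence_le_iff (hf : IsDivergenceGenerator f) {m' : Measure Ω} {ρ : ℝ} :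
    fDivergence f m' m ≤ (ρ : EReal) ↔
      extIntegral m (fun ω => f (m'.rnDeriv m ω).toReal) ≤ ((ρ + (f 1).toReal : ℝ) : EReal) := by
  unfold fDivergence
  rw [EReal.coe_add, hf.coe_toReal hf.one_ne_top]
  exact EReal.sub_le_iff_le_add (.inl (hf.ne_bot 1)) (.inl hf.one_ne_top)

/-- The affine minorant of `f` at 1, evaluated at the density, is integrable; hence an upper bound
on the divergence forces genuine integrability, and real integrals can be used from here on. -/
theorem mem_uncertaintySet_iff [IsProbabilityMeasure m] (hf : IsDivergenceGenerator f)
    {ρ : ℝ} {m' : Measure Ω} [IsProbabilityMeasure m'] (hac : m' ≪ m) :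
    m' ∈ uncertaintySet f ρ m ↔ (∀ᵐ ω ∂m, f (m'.rnDeriv m ω).toReal ≠ ⊤) ∧
      Integrable (fun ω => (f (m'.rnDeriv m ω).toReal).toReal) m ∧
      ∫ ω, (f (m'.rnDeriv m ω).toReal).toReal ∂m ≤ ρ + (f 1).toReal := by
  constructor
  · rintro ⟨-, -, hdiv⟩
    rw [fDivergence_le_iff hf] at hdiv
    obtain ⟨s, hs⟩ := hf.exists_subgradient_one
    have hZ : Integrable (fun ω => (m'.rnDeriv m ω).toReal) m := Measure.integrable_toReal_rnDeriv
    obtain ⟨h1, h2⟩ := integrable_toReal_of_extIntegral_lt_top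
      (hf.measurable.comp (m'.measurable_rnDeriv m).ennreal_toReal)
      (L := fun ω => (f 1).toReal + s * ((m'.rnDeriv m ω).toReal - 1))
      ((integrable_const _).add ((hZ.sub (integrable_const 1)).const_mul s))
      (.of_forall fun ω => by
        simp only [Function.comp_apply]
        by_cases h : f (m'.rnDeriv m ω).toReal = ⊤
        · rw [h]; exact le_top
        · rw [← hf.coe_toReal h]
          exact EReal.coe_le_coe_iff.mpr (hs _ (hf.mem_realEpigraph h)))
      (hdiv.trans_lt (EReal.coe_lt_top _))
    refine ⟨h1, h2, ?_⟩
    have h3 := extIntegral_eq_integral_toReal (fun ω => hf.ne_bot _) h1 h2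
    rw [h3] at hdiv
    exact_mod_cast hdiv
  · rintro ⟨h1, h2, h3⟩
    refine ⟨inferInstance, hac, ?_⟩
    rw [fDivergence_le_iff hf, extIntegral_eq_integral_toReal (fun ω => hf.ne_bot _) h1 h2]
    exact_mod_cast h3

/-- Simple densities give members of the uncertainty set. -/
theorem exists_mem_uncertaintySet_of_simpleFunc [IsProbabilityMeasure m]
    (hf : IsDivergenceGenerator f) {ρ : ℝ} {s : SimpleFunc Ω (ℝ × ℝ)}
    (hs : ∀ ω, s ω ∈ realEpigraph f) (h1 : ∫ ω, (s ω).1 ∂m = 1)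
    (h2 : ∫ ω, (s ω).2 ∂m ≤ ρ + (f 1).toReal) (X : Ω → ℝ) :
    ∃ m' ∈ uncertaintySet f ρ m, ∫ ω, X ω ∂m' = ∫ ω, (s ω).1 * X ω ∂m := by
  have hmeas : Measurable fun ω => ENNReal.ofReal (s ω).1 :=
    (s.map Prod.fst).measurable.ennreal_ofReal
  have hnn : ∀ ω, 0 ≤ (s ω).1 := fun ω => hf.nonneg_of_mem (hs ω)
  have hint1 : Integrable (fun ω => (s ω).1) m := (s.map Prod.fst).integrable_of_isFiniteMeasure
  have hint2 : Integrable (fun ω => (s ω).2) m := (s.map Prod.snd).integrable_of_isFiniteMeasure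
  have hprob : IsProbabilityMeasure (m.withDensity fun ω => ENNReal.ofReal (s ω).1) := by
    constructor
    rw [withDensity_apply _ MeasurableSet.univ, Measure.restrict_univ,
      ← ofReal_integral_eq_lintegral_ofReal hint1 (.of_forall hnn), h1, ENNReal.ofReal_one]
  refine ⟨m.withDensity fun ω => ENNReal.ofReal (s ω).1, ?_, ?_⟩
  · rw [mem_uncertaintySet_iff hf (withDensity_absolutelyContinuous _ _)]
    have hae : ∀ᵐ ω ∂m, ((m.withDensity fun ω => ENNReal.ofReal (s ω).1).rnDeriv m ω).toReal =
        (s ω).1 := (Measure.rnDeriv_withDensity m hmeas).mono fun ω hω => by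
      rw [hω, ENNReal.toReal_ofReal (hnn ω)]
    have hint3 : Integrable (fun ω => (f (s ω).1).toReal) m :=
      (s.map fun p : ℝ × ℝ => (f p.1).toReal).integrable_of_isFiniteMeasure
    refine ⟨hae.mono fun ω hω => ?_, hint3.congr (hae.mono fun ω hω => by simp only [hω]), ?_⟩
    · rw [hω]
      exact ((show f (s ω).1 ≤ ((s ω).2 : EReal) from hs ω).trans_lt (EReal.coe_lt_top _)).ne
    · rw [integral_congr_ae (hae.mono fun ω hω => by simp only [hω] :
        _ =ᵐ[m] fun ω => (f (s ω).1).toReal)]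
      exact (integral_mono hint3 hint2 fun ω => hf.toReal_le (hs ω)).trans h2
  · rw [integral_withDensity_eq_integral_toReal_smul hmeas
      (.of_forall fun ω => ENNReal.ofReal_lt_top)]
    simp only [smul_eq_mul, ENNReal.toReal_ofReal (hnn _)]

theorem self_mem_uncertaintySet [IsProbabilityMeasure m] (hf : IsDivergenceGenerator f) {ρ : ℝ}
    (hρ : 0 ≤ ρ) : m ∈ uncertaintySet f ρ m := by
  have hae : ∀ᵐ ω ∂m, (m.rnDeriv m ω).toReal = 1 := m.rnDeriv_self.mono fun ω hω => by simp [hω]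
  rw [mem_uncertaintySet_iff hf Measure.AbsolutelyContinuous.rfl]
  have hae' : (fun ω => (f (m.rnDeriv m ω).toReal).toReal) =ᵐ[m] fun _ => (f 1).toReal :=
    hae.mono fun ω hω => by simp only [hω]
  refine ⟨hae.mono fun ω hω => by rw [hω]; exact hf.one_ne_top,
    (integrable_const _).congr hae'.symm, ?_⟩
  rw [integral_congr_ae hae']
  simpa using hρ

/-- Weak duality. -/
theorem worstCaseLoss_le_reducedCost [IsProbabilityMeasure m] (hf : IsDivergenceGenerator f)
    {ρ : ℝ} {X : Ω → ℝ} (hX : ∀ m' ∈ uncertaintySet f ρ m, Integrable X m') {lam : ℝ}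
    (hlam : 0 < lam) (μ : ℝ) : worstCaseLoss f ρ m X ≤ reducedCost f ρ m X lam μ := by
  refine iSup₂_le fun m' hm' => ?_
  have hprob : IsProbabilityMeasure m' := hm'.1
  have hac : m' ≪ m := hm'.2.1
  obtain ⟨h1, h2, h3⟩ := (mem_uncertaintySet_iff hf hac).mp hm'
  have hZ : Integrable (fun ω => (m'.rnDeriv m ω).toReal) m := Measure.integrable_toReal_rnDeriv
  have hZX : Integrable (fun ω => (m'.rnDeriv m ω).toReal * X ω) m :=
    (integrable_rnDeriv_smul_iff hac).mpr (hX m' hm')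
  refine le_trans ?_ (le_reducedCost hf hlam (h1.mono fun ω hω => hf.mem_realEpigraph hω)
    (integrable_lagrangian hZX hZ h2 lam μ))
  have hXm : ∫ ω, (m'.rnDeriv m ω).toReal * X ω ∂m = ∫ ω, X ω ∂m' := integral_rnDeriv_smul hac
  rw [EReal.coe_le_coe_iff, integral_lagrangian hZX hZ h2, hXm,
    Measure.integral_toReal_rnDeriv hac]
  simp only [probReal_univ]
  nlinarith

/-- Strong duality, as an inequality. -/
theorem minReducedCost_le [IsProbabilityMeasure m] (hf : IsDivergenceGenerator f)
    {ρ : ℝ} (hρ : 0 < ρ) {X : Ω → ℝ} (hX : Integrable X m) {V : ℝ}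
    (hV : worstCaseLoss f ρ m X ≤ (V : EReal)) : minReducedCost f ρ m X ≤ (V : EReal) := by
  set c₁ := (f 1).toReal with hc₁
  -- Attainable triples: expected loss, bound on the divergence integral, mass. Mass is left free
  -- for now, so that it too can receive a multiplier.
  let C : Set (ℝ × ℝ × ℝ) := {p | ∃ s : SimpleFunc Ω (ℝ × ℝ), (∀ ω, s ω ∈ realEpigraph f) ∧
    p = (∫ ω, (s ω).1 * X ω ∂m, ∫ ω, (s ω).2 ∂m, ∫ ω, (s ω).1 ∂m)}
  have hi1 : ∀ s : SimpleFunc Ω (ℝ × ℝ), Integrable (fun ω => (s ω).1) m := fun s =>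
    (s.map Prod.fst).integrable_of_isFiniteMeasure
  have hi2 : ∀ s : SimpleFunc Ω (ℝ × ℝ), Integrable (fun ω => (s ω).2) m := fun s =>
    (s.map Prod.snd).integrable_of_isFiniteMeasure
  have hiX : ∀ s : SimpleFunc Ω (ℝ × ℝ), Integrable (fun ω => (s ω).1 * X ω) m := fun s => by
    simpa using SimpleFunc.integrable_fst_mul_sub s hX 0
  have hC : Convex ℝ C := by
    rintro _ ⟨s, hs, rfl⟩ _ ⟨t, ht, rfl⟩ a b ha hb hab
    refine ⟨a • s + b • t, fun ω => hf.convex_realEpigraph (hs ω) (ht ω) ha hb hab, ?_⟩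
    simp only [SimpleFunc.coe_add, SimpleFunc.coe_smul, Pi.add_apply, Pi.smul_apply, Prod.fst_add,
      Prod.snd_add, Prod.smul_fst, Prod.smul_snd, smul_eq_mul, Prod.smul_mk, Prod.mk_add_mk, add_mul,
      mul_assoc]
    rw [integral_add ((hiX s).const_mul a) ((hiX t).const_mul b),
      integral_add ((hi2 s).const_mul a) ((hi2 t).const_mul b),
      integral_add ((hi1 s).const_mul a) ((hi1 t).const_mul b)]
    simp only [integral_const_mul]
  have hconst : ∀ p ∈ realEpigraph f, (p.1 * ∫ ω, X ω ∂m, p.2, p.1) ∈ C := fun p hp =>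
    ⟨SimpleFunc.const Ω p, fun _ => hp, by simp [integral_const_mul]⟩
  have hle : ∀ u v, (u, v, (1 : ℝ)) ∈ C → v ≤ ρ + c₁ → u ≤ V := by
    rintro u v ⟨s, hs, hsv⟩ hv
    obtain ⟨rfl, rfl, h1⟩ : u = _ ∧ v = _ ∧ (1 : ℝ) = _ := by simpa [Prod.ext_iff] using hsv
    obtain ⟨m', hm', hm'X⟩ := exists_mem_uncertaintySet_of_simpleFunc hf hs h1.symm hv X
    rw [← hm'X]
    exact_mod_cast (le_iSup₂ (f := fun m' (_ : m' ∈ uncertaintySet f ρ m) =>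
      ((∫ ω, X ω ∂m' : ℝ) : EReal)) m' hm').trans hV
  -- the multiplier of the divergence constraint
  obtain ⟨lam, hlam0, hlam⟩ := exists_multiplier_of_le
    (K := {p : ℝ × ℝ | (p.1, p.2 + (ρ + c₁), (1 : ℝ)) ∈ C}) (V := V)
    (by
      intro p hp q hq a b ha hb hab
      have := hC hp hq ha hb hab
      have heq : a • (p.1, p.2 + (ρ + c₁), (1 : ℝ)) + b • (q.1, q.2 + (ρ + c₁), (1 : ℝ)) =
          ((a • p + b • q).1, (a • p + b • q).2 + (ρ + c₁), (1 : ℝ)) := by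
        refine Prod.ext ?_ (Prod.ext ?_ ?_)
        · simp
        · simp; linear_combination (ρ + c₁) * hab
        · simp [hab]
      rwa [heq] at this)
    (fun p hp h => hle _ _ hp (by linarith))
    ⟨(1 * ∫ ω, X ω ∂m, -ρ), by
      have := hconst _ (hf.mem_realEpigraph hf.one_ne_top)
      simp only [mem_ofPred_eq]
      convert this using 3
      simp [hc₁], by simpa using hρ⟩
  -- the multiplier of the mass constraint
  obtain ⟨δ, hδ, hδ1, hδ2⟩ := hf.exists_near_one
  obtain ⟨μ, hμ⟩ := exists_multiplier_of_eq
    (K := {q : ℝ × ℝ | ∃ p ∈ C, q = (p.1 - lam * (p.2.1 - (ρ + c₁)), p.2.2 - 1)}) (V := V)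
    (by
      rintro _ ⟨p, hp, rfl⟩ _ ⟨q, hq, rfl⟩ a b ha hb hab
      refine ⟨_, hC hp hq ha hb hab, ?_⟩
      refine Prod.ext ?_ ?_
      · simp; linear_combination (lam * (ρ + c₁)) * hab
      · simp; linear_combination (-1 : ℝ) * hab)
    (by
      rintro u ⟨p, hp, hpu⟩
      obtain ⟨rfl, h2⟩ : u = _ ∧ (0 : ℝ) = _ := by simpa [Prod.ext_iff] using hpu
      refine hlam (p.1, p.2.1 - (ρ + c₁)) ?_
      have h3 : p.2.2 = 1 := by linarith
      simp only [mem_ofPred_eq, sub_add_cancel]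
      rwa [← h3])
    -- The constant densities `1 + δ` and `1 - δ` violate the mass constraint in both directions.
    ⟨_, ⟨_, hconst _ (hf.mem_realEpigraph hδ2), rfl⟩, by simpa using hδ⟩
    ⟨_, ⟨_, hconst _ (hf.mem_realEpigraph hδ1), rfl⟩, by simpa using hδ⟩
  obtain ⟨s₀, hs₀⟩ := hf.exists_subgradient_one
  refine EReal.le_of_forall_lt_iff_le.mp fun z hz => ?_
  have hz' : V < z := by exact_mod_cast hz
  -- The multiplier `lam` may be 0, which the infimum excludes. Raising it by `η` and shifting `μ`
  -- by `-η * s₀` costs at most `η * ρ = z - V`, thanks to the affine minorant with slope `s₀`.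
  set η := (z - V) / ρ with hη
  have hηpos : 0 < η := div_pos (by linarith) hρ
  have hηρ : η * ρ = z - V := div_mul_cancel₀ _ hρ.ne'
  refine (iInf₂_le (lam + η) (by linarith)).trans ((iInf_le _ (μ - η * s₀)).trans ?_)
  rw [reducedCost_le_iff hf hX (by linarith)]
  intro s hs
  have h1 := hμ _ ⟨_, ⟨s, hs, rfl⟩, rfl⟩
  simp only at h1
  have h2 : c₁ + s₀ * (∫ ω, (s ω).1 ∂m - 1) ≤ ∫ ω, (s ω).2 ∂m := by
    have hlow : Integrable (fun ω => s₀ * ((s ω).1 - 1)) m :=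
      ((hi1 s).sub (integrable_const 1)).const_mul s₀
    have h := integral_mono ((integrable_const c₁).add hlow) (hi2 s) fun ω => hs₀ _ (hs ω)
    rw [integral_add' (integrable_const _) hlow, integral_const_mul,
      integral_sub (hi1 s) (integrable_const 1)] at h
    simpa using h
  rw [integral_lagrangian (hiX s) (hi1 s) (hi2 s)]
  nlinarith [mul_le_mul_of_nonneg_left h2 hηpos.le]

end Duality

/-! ### Countable mixtures and finiteness of the worst case. -/

/-- Jensen's inequality for countable mixtures that give positive weight to the point `1`, for the
generator normalized by an affine minorant. -/
theorem IsDivergenceGenerator.le_tsum {f : ℝ → EReal} (hf : IsDivergenceGenerator f) (s₀ : ℝ)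
    {W z : ℕ → ℝ} {y : ℝ} (hs₀ : ∀ p ∈ realEpigraph f, (f 1).toReal + s₀ * (p.1 - 1) ≤ p.2)
    (hW : ∀ n, 0 < W n) (hW1 : HasSum W 1) (hz0 : z 0 = 1) (hz : ∀ n, f (z n) ≠ ⊤)
    (hy : HasSum (fun n => W n * z n) y) :
    f y ≠ ⊤ ∧ ENNReal.ofReal ((f y).toReal - (f 1).toReal - s₀ * (y - 1)) ≤
      ∑' n, ENNReal.ofReal (W n * ((f (z n)).toReal - (f 1).toReal - s₀ * (z n - 1))) := by
  obtain ⟨δ, hδ, hδ1, hδ2⟩ := hf.exists_near_one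
  have hWy : HasSum (fun n => W n * y) y := by simpa using hW1.mul_right y
  -- If `y` were an endpoint of the domain other than 1, all `z n` would lie on one side of it and
  -- `z 0 = 1` strictly so, with positive weight; `y` could not be their mean. So a subgradient
  -- exists at `y`.
  have ha : ∃ a, a < y ∧ f a ≠ ⊤ := by
    rcases lt_trichotomy y 1 with h | h | h
    · by_contra! hcon
      have hle : ∀ n, y ≤ z n := fun n => by
        by_contra! hlt
        exact hz n (hcon _ hlt)
      refine lt_irrefl y (hasSum_lt (i := 0) (fun n => ?_) ?_ hWy hy)
      · exact mul_le_mul_of_nonneg_left (hle n) (hW n).le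
      · exact mul_lt_mul_of_pos_left (hz0 ▸ h) (hW 0)
    · exact ⟨1 - δ, by linarith, hδ1⟩
    · exact ⟨1, h, hf.one_ne_top⟩
  have hb : ∃ b, y < b ∧ f b ≠ ⊤ := by
    rcases lt_trichotomy y 1 with h | h | h
    · exact ⟨1, h, hf.one_ne_top⟩
    · exact ⟨1 + δ, by linarith, hδ2⟩
    · by_contra! hcon
      have hle : ∀ n, z n ≤ y := fun n => by
        by_contra! hlt
        exact hz n (hcon _ hlt)
      refine lt_irrefl y (hasSum_lt (i := 0) (fun n => ?_) ?_ hy hWy)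
      · exact mul_le_mul_of_nonneg_left (hle n) (hW n).le
      · exact mul_lt_mul_of_pos_left (hz0 ▸ h) (hW 0)
  obtain ⟨a, hay, ha⟩ := ha
  obtain ⟨b, hyb, hb⟩ := hb
  refine ⟨hf.ne_top_of_mem_Icc ha hb ⟨hay.le, hyb.le⟩, ?_⟩
  obtain ⟨k, hk⟩ := hf.exists_subgradient ha hb hay hyb
  set g : ℕ → ℝ := fun n => W n * ((f (z n)).toReal - (f 1).toReal - s₀ * (z n - 1)) with hg
  have hg0 : ∀ n, 0 ≤ g n := fun n => mul_nonneg (hW n).le (by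
    have := hs₀ _ (hf.mem_realEpigraph (hz n))
    simp only at this
    linarith)
  by_cases htop : ∑' n, ENNReal.ofReal (g n) = ⊤
  · rw [htop]; exact le_top
  have hsum : Summable g := by
    have := ENNReal.summable_toReal htop
    simpa only [ENNReal.toReal_ofReal (hg0 _)] using this
  rw [← ENNReal.ofReal_tsum_of_nonneg hg0 hsum]
  refine ENNReal.ofReal_le_ofReal ?_
  have hlow : HasSum (fun n => W n * ((f y).toReal - (f 1).toReal - s₀ * (y - 1)) +
      (k - s₀) * (W n * z n - W n * y)) ((f y).toReal - (f 1).toReal - s₀ * (y - 1)) := by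
    simpa using (hW1.mul_right ((f y).toReal - (f 1).toReal - s₀ * (y - 1))).add
      ((hy.sub hWy).mul_left (k - s₀))
  refine hasSum_le (fun n => ?_) hlow hsum.hasSum
  have h1 := mul_le_mul_of_nonneg_left (hk _ (hf.mem_realEpigraph (hz n))) (hW n).le
  simp only at h1
  simp only [hg]
  linarith

section Mixture

variable {Ω : Type*} [MeasurableSpace Ω] {m : Measure Ω} {f : ℝ → EReal}

/-- The uncertainty set is closed under countable mixtures containing the reference measure. -/
theorem sum_smul_mem_uncertaintySet [IsProbabilityMeasure m] (hf : IsDivergenceGenerator f)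
    {ρ : ℝ} {W : ℕ → ℝ} (hW : ∀ n, 0 < W n) (hW1 : HasSum W 1)
    {M : ℕ → Measure Ω} (hM0 : M 0 = m) (hM : ∀ n, M n ∈ uncertaintySet f ρ m) :
    Measure.sum (fun n => ENNReal.ofReal (W n) • M n) ∈ uncertaintySet f ρ m := by
  have hρ : ∀ n, IsProbabilityMeasure (M n) := fun n => (hM n).1
  have hac : ∀ n, M n ≪ m := fun n => (hM n).2.1
  set Mb := Measure.sum fun n => ENNReal.ofReal (W n) • M n with hMb
  have hWt : ∑' n, ENNReal.ofReal (W n) = 1 := by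
    rw [← ENNReal.ofReal_tsum_of_nonneg (fun n => (hW n).le) hW1.summable, hW1.tsum_eq,
      ENNReal.ofReal_one]
  have hprob : IsProbabilityMeasure Mb := by
    constructor
    rw [hMb, Measure.sum_apply _ MeasurableSet.univ]
    simpa using hWt
  have hacb : Mb ≪ m := Measure.absolutelyContinuous_sum_left fun n => (hac n).smul_left _
  have hdens : Mb = m.withDensity (∑' n, ENNReal.ofReal (W n) • (M n).rnDeriv m) := by
    rw [withDensity_tsum fun n => ((M n).measurable_rnDeriv m).const_smul _, hMb]
    congr 1
    ext1 n
    rw [withDensity_smul _ ((M n).measurable_rnDeriv m), Measure.withDensity_rnDeriv_eq _ _ (hac n)]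
  have hmeasb : Measurable (∑' n, ENNReal.ofReal (W n) • (M n).rnDeriv m) := by
    have : (∑' n, ENNReal.ofReal (W n) • (M n).rnDeriv m) =
        fun ω => ∑' n, ENNReal.ofReal (W n) * (M n).rnDeriv m ω := by
      ext ω
      rw [tsum_apply (Pi.summable.mpr fun _ => ENNReal.summable)]
      rfl
    rw [this]
    exact Measurable.tsum fun n => ((M n).measurable_rnDeriv m).const_mul _
  have hrn : ∀ᵐ ω ∂m, HasSum (fun n => W n * ((M n).rnDeriv m ω).toReal)
      (Mb.rnDeriv m ω).toReal := by
    have h1 : Mb.rnDeriv m =ᵐ[m] ∑' n, ENNReal.ofReal (W n) • (M n).rnDeriv m := by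
      conv_lhs => rw [hdens]
      exact Measure.rnDeriv_withDensity m hmeasb
    filter_upwards [h1, Mb.rnDeriv_lt_top m] with ω h2 h3
    rw [tsum_apply (Pi.summable.mpr fun _ => ENNReal.summable)] at h2
    rw [h2] at h3 ⊢
    have h4 := ENNReal.hasSum_toReal h3.ne
    rw [← ENNReal.tsum_toReal_eq fun n => ENNReal.ne_top_of_tsum_ne_top h3.ne n] at h4
    simpa [ENNReal.toReal_mul, ENNReal.toReal_ofReal (hW _).le] using h4
  obtain ⟨s₀, hs₀⟩ := hf.exists_subgradient_one
  -- Subtracting the affine minorant makes the integrand nonnegative on the domain, so sums and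
  -- integrals can be exchanged; at a probability density the affine part integrates to `f 1`.
  let G : ℝ → ℝ := fun x => (f x).toReal - (f 1).toReal - s₀ * (x - 1)
  have hG0 : ∀ x, f x ≠ ⊤ → 0 ≤ G x := fun x hx => by
    have := hs₀ _ (hf.mem_realEpigraph hx)
    simp only [G] at this ⊢
    linarith
  have hGm : Measurable G := (hf.measurable.ereal_toReal.sub_const _).sub
    ((measurable_id.sub_const 1).const_mul s₀)
  have hz0 : ∀ᵐ ω ∂m, ((M 0).rnDeriv m ω).toReal = 1 := by
    rw [hM0]
    exact m.rnDeriv_self.mono fun ω hω => by simp [hω]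
  have hdom := fun n => ((mem_uncertaintySet_iff hf (hac n)).mp (hM n)).1
  have hjensen : ∀ᵐ ω ∂m, f (Mb.rnDeriv m ω).toReal ≠ ⊤ ∧
      ENNReal.ofReal (G (Mb.rnDeriv m ω).toReal) ≤
        ∑' n, ENNReal.ofReal (W n * G ((M n).rnDeriv m ω).toReal) := by
    filter_upwards [hrn, hz0, ae_all_iff.mpr hdom] with ω h1 h2 h3
    exact hf.le_tsum s₀ hs₀ hW hW1 h2 h3 h1
  have hGint : ∀ (M' : Measure Ω) [IsProbabilityMeasure M'], M' ≪ m →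
      Integrable (fun ω => (f (M'.rnDeriv m ω).toReal).toReal) m →
      Integrable (fun ω => G (M'.rnDeriv m ω).toReal) m ∧
        ∫ ω, G (M'.rnDeriv m ω).toReal ∂m =
          ∫ ω, (f (M'.rnDeriv m ω).toReal).toReal ∂m - (f 1).toReal := by
    intro M' _ hac' hint
    have hZ : Integrable (fun ω => (M'.rnDeriv m ω).toReal) m := Measure.integrable_toReal_rnDeriv
    have hZ1 : Integrable (fun ω => s₀ * ((M'.rnDeriv m ω).toReal - 1)) m :=
      (hZ.sub (integrable_const 1)).const_mul s₀
    have hc : Integrable (fun ω => (f (M'.rnDeriv m ω).toReal).toReal - (f 1).toReal) m :=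
      hint.sub (integrable_const _)
    refine ⟨hc.sub hZ1, ?_⟩
    simp only [G]
    rw [integral_sub hc hZ1, integral_sub hint (integrable_const _), integral_const_mul,
      integral_sub hZ (integrable_const 1), Measure.integral_toReal_rnDeriv hac']
    simp
  have hbound : ∫⁻ ω, ENNReal.ofReal (G (Mb.rnDeriv m ω).toReal) ∂m ≤ ENNReal.ofReal ρ := by
    refine (lintegral_mono_ae (hjensen.mono fun ω hω => hω.2)).trans ?_
    have hGM : ∀ n, Measurable fun ω => G ((M n).rnDeriv m ω).toReal := fun n =>
      hGm.comp ((M n).measurable_rnDeriv m).ennreal_toReal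
    rw [lintegral_tsum fun n => ((hGM n).const_mul _).ennreal_ofReal.aemeasurable]
    have hterm : ∀ n, ∫⁻ ω, ENNReal.ofReal (W n * G ((M n).rnDeriv m ω).toReal) ∂m ≤
        ENNReal.ofReal (W n) * ENNReal.ofReal ρ := by
      intro n
      obtain ⟨h1, h2, h3⟩ := (mem_uncertaintySet_iff hf (hac n)).mp (hM n)
      obtain ⟨h4, h5⟩ := hGint (M n) (hac n) h2
      rw [← ofReal_integral_eq_lintegral_ofReal (h4.const_mul _)
        (h1.mono fun ω hω => mul_nonneg (hW n).le (hG0 _ hω)), integral_const_mul,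
        ENNReal.ofReal_mul (hW n).le]
      gcongr
      linarith
    refine (ENNReal.tsum_le_tsum hterm).trans ?_
    rw [ENNReal.tsum_mul_right, hWt, one_mul]
  have hGbm : Measurable fun ω => G (Mb.rnDeriv m ω).toReal :=
    hGm.comp (Mb.measurable_rnDeriv m).ennreal_toReal
  have hGb0 : 0 ≤ᵐ[m] fun ω => G (Mb.rnDeriv m ω).toReal :=
    hjensen.mono fun ω hω => hG0 _ hω.1
  have hGbi : Integrable (fun ω => G (Mb.rnDeriv m ω).toReal) m :=
    (lintegral_ofReal_ne_top_iff_integrable hGbm.aestronglyMeasurable hGb0).mp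
      (hbound.trans_lt ENNReal.ofReal_lt_top).ne
  have hfbi : Integrable (fun ω => (f (Mb.rnDeriv m ω).toReal).toReal) m := by
    have hZ : Integrable (fun ω => (Mb.rnDeriv m ω).toReal) m := Measure.integrable_toReal_rnDeriv
    refine (hGbi.add ((integrable_const (f 1).toReal).add
      ((hZ.sub (integrable_const 1)).const_mul s₀))).congr (.of_forall fun ω => ?_)
    simp only [Pi.add_apply, Pi.sub_apply, G]
    ring
  rw [mem_uncertaintySet_iff hf hacb]
  refine ⟨hjensen.mono fun ω hω => hω.1, hfbi, ?_⟩
  have h1 := (hGint Mb hacb hfbi).2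
  have hρ0 : 0 ≤ ρ := by
    obtain ⟨h1, h2, h3⟩ := (mem_uncertaintySet_iff hf (hac 0)).mp (hM 0)
    obtain ⟨h4, h5⟩ := hGint (M 0) (hac 0) h2
    have := integral_nonneg_of_ae (h1.mono fun ω hω => hG0 _ hω)
    linarith
  rw [← ofReal_integral_eq_lintegral_ofReal hGbi hGb0, ENNReal.ofReal_le_ofReal_iff hρ0] at hbound
  linarith

/-- If the loss is integrable for all measures of the uncertainty set, its worst case is finite. -/
theorem worstCaseLoss_lt_top [IsProbabilityMeasure m] (hf : IsDivergenceGenerator f)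
    {ρ : ℝ} (hρ : 0 ≤ ρ) {X : Ω → ℝ} (hX : ∀ m' ∈ uncertaintySet f ρ m, Integrable X m') :
    worstCaseLoss f ρ m X < ⊤ := by
  by_contra htop
  -- The factor `2 ^ (n + 2)` cancels the weight `W (n + 1)` given to `M n` below, slot 0 being
  -- reserved for `m`. Each component then contributes at least `n` to the integral of `|X|`.
  have hex : ∀ n : ℕ, ∃ m' ∈ uncertaintySet f ρ m, (n * 2 ^ (n + 2) : ℝ) < ∫ ω, X ω ∂m' := by
    intro n
    have h : ((n * 2 ^ (n + 2) : ℝ) : EReal) < worstCaseLoss f ρ m X := by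
      rw [not_lt_top_iff.mp htop]
      exact EReal.coe_lt_top _
    obtain ⟨m', hm'⟩ := lt_iSup_iff.mp h
    obtain ⟨hmem, hlt⟩ := lt_iSup_iff.mp hm'
    exact ⟨m', hmem, by exact_mod_cast hlt⟩
  choose M hM hMX using hex
  let W : ℕ → ℝ := fun n => 1 / 2 / 2 ^ n
  let M' : ℕ → Measure Ω := fun n => Nat.casesOn n m M
  have hmem := sum_smul_mem_uncertaintySet hf (W := W) (M := M') (fun n => by positivity)
    (hasSum_geometric_two' 1) rfl (fun n => by
      cases n with
      | zero => exact self_mem_uncertaintySet hf hρ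
      | succ n => exact hM n)
  have hint := hX _ hmem
  set C := ∫⁻ ω, ‖X ω‖ₑ ∂(Measure.sum fun n => ENNReal.ofReal (W n) • M' n) with hC
  have hCtop : C ≠ ⊤ := hint.2.ne
  have hle : ∀ n : ℕ, (n : ℝ) ≤ C.toReal := by
    intro n
    have h1 : ENNReal.ofReal (W (n + 1)) * ∫⁻ ω, ‖X ω‖ₑ ∂(M n) ≤ C := by
      have := lintegral_mono' (Measure.le_sum (fun n => ENNReal.ofReal (W n) • M' n) (n + 1))
        (le_refl fun ω => ‖X ω‖ₑ)
      rwa [lintegral_smul_measure] at this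
    have h2 : ENNReal.ofReal (n * 2 ^ (n + 2)) ≤ ∫⁻ ω, ‖X ω‖ₑ ∂(M n) := by
      rw [← ofReal_integral_norm_eq_lintegral_enorm (hX _ (hM n))]
      exact ENNReal.ofReal_le_ofReal ((hMX n).le.trans
        ((le_abs_self _).trans (by simpa using norm_integral_le_integral_norm X)))
    have h3 : ENNReal.ofReal n ≤ C := by
      refine le_trans ?_ ((mul_le_mul_right h2 _).trans h1)
      rw [← ENNReal.ofReal_mul (by positivity)]
      refine ENNReal.ofReal_le_ofReal (le_of_eq ?_)
      simp only [W]
      field_simp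
      ring
    exact (ENNReal.ofReal_le_iff_le_toReal hCtop).mp h3
  obtain ⟨n, hn⟩ := exists_nat_gt C.toReal
  exact absurd (hle n) (not_le.mpr hn)

end Mixture

/-! ### Minimising out the multipliers. -/

/-- Minimizing out multipliers preserves joint quasiconvexity. -/
theorem quasiconvexOn_iInf_multipliers {E : Type*} [AddCommGroup E] [Module ℝ E] {S : Set E}
    {F : E → ℝ → ℝ → EReal}
    (hF : QuasiconvexOn ℝ (S ×ˢ Ioi (0 : ℝ) ×ˢ (univ : Set ℝ))
      fun z : E × ℝ × ℝ => F z.1 z.2.1 z.2.2) (hS : Convex ℝ S) :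
    QuasiconvexOn ℝ S fun x => ⨅ (lam : ℝ) (_ : 0 < lam) (μ : ℝ), F x lam μ := by
  rintro r x ⟨hx, hxr⟩ y ⟨hy, hyr⟩ a b ha hb hab
  -- The infima need not be attained, hence the room up to `r'`.
  refine ⟨hS hx hy ha hb hab, le_of_forall_gt_imp_ge_of_dense fun r' hr' => ?_⟩
  obtain ⟨l₁, h1⟩ := iInf_lt_iff.mp (hxr.trans_lt hr')
  obtain ⟨hl₁, h1⟩ := iInf_lt_iff.mp h1
  obtain ⟨μ₁, h1⟩ := iInf_lt_iff.mp h1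
  obtain ⟨l₂, h2⟩ := iInf_lt_iff.mp (hyr.trans_lt hr')
  obtain ⟨hl₂, h2⟩ := iInf_lt_iff.mp h2
  obtain ⟨μ₂, h2⟩ := iInf_lt_iff.mp h2
  obtain ⟨⟨-, hlam, -⟩, hle⟩ := hF r' (x := (x, l₁, μ₁)) ⟨⟨hx, hl₁, mem_univ _⟩, h1.le⟩
    (y := (y, l₂, μ₂)) ⟨⟨hy, hl₂, mem_univ _⟩, h2.le⟩ ha hb hab
  exact (iInf₂_le _ hlam).trans ((iInf_le _ _).trans hle)

/-- Minimizing out multipliers preserves joint continuity, for costs that are convex and coercive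
in the multipliers, even though the multiplier `lam` ranges over an open half-line. -/
theorem continuous_iInf_multipliers {Y : Type*} [TopologicalSpace Y] {F : Y → ℝ → ℝ → EReal}
    (hcont : ∀ y lam μ, 0 < lam →
      ContinuousAt (fun z : Y × ℝ × ℝ => F z.1 z.2.1 z.2.2) (y, lam, μ))
    (hconv : ∀ y lam₀ μ₀ lam₁ μ₁ (M c s : ℝ), 0 < lam₀ → 0 < lam₁ → F y lam₀ μ₀ ≤ M →
      F y lam₁ μ₁ ≤ c → 0 ≤ s → s ≤ 1 →
      F y ((1 - s) * lam₀ + s * lam₁) ((1 - s) * μ₀ + s * μ₁) ≤ (((1 - s) * M + s * c : ℝ) : EReal))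
    (hcoer : ∀ y, ∃ κ C : ℝ, 0 < κ ∧ ∀ lam μ, 0 < lam →
      ((κ * (lam + |μ|) - C : ℝ) : EReal) ≤ F y lam μ)
    (hfin : ∀ y, (⨅ (lam : ℝ) (_ : 0 < lam) (μ : ℝ), F y lam μ) ≠ ⊤) :
    Continuous fun y => ⨅ (lam : ℝ) (_ : 0 < lam) (μ : ℝ), F y lam μ := by
  have hle : ∀ y lam μ, 0 < lam → (⨅ (lam : ℝ) (_ : 0 < lam) (μ : ℝ), F y lam μ) ≤ F y lam μ :=
    fun y lam μ h => (iInf₂_le lam h).trans (iInf_le _ μ)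
  have hlt : ∀ y c, (⨅ (lam : ℝ) (_ : 0 < lam) (μ : ℝ), F y lam μ) < c →
      ∃ lam μ, 0 < lam ∧ F y lam μ < c := by
    intro y c h
    obtain ⟨l, h⟩ := iInf_lt_iff.mp h
    obtain ⟨hl, h⟩ := iInf_lt_iff.mp h
    obtain ⟨μ, h⟩ := iInf_lt_iff.mp h
    exact ⟨l, μ, hl, h⟩
  have hcont1 : ∀ y lam μ, 0 < lam → ContinuousAt (fun y' => F y' lam μ) y := fun y lam μ h =>
    ContinuousAt.comp (g := fun z : Y × ℝ × ℝ => F z.1 z.2.1 z.2.2)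
      (f := fun y' => (y', lam, μ)) (hcont y lam μ h) (by fun_prop)
  refine continuous_iff_continuousAt.mpr fun y => tendsto_order.mpr ⟨fun c hc => ?_, fun c hc => ?_⟩
  swap
  -- Upper semicontinuity holds for any infimum of continuous functions; the remainder is lower
  -- semicontinuity.
  · obtain ⟨lam, μ, hlam, h⟩ := hlt y c hc
    filter_upwards [(hcont1 y lam μ hlam).tendsto.eventually_lt_const h] with y' hy'
    exact (hle y' lam μ hlam).trans_lt hy'
  obtain ⟨c₀, hcc₀, hc₀⟩ := EReal.lt_iff_exists_real_btwn.mp hc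
  obtain ⟨c₁, hc₀₁, hc₁⟩ := EReal.lt_iff_exists_real_btwn.mp hc₀
  obtain ⟨lam₀, μ₀, hlam₀, hz₀⟩ := hlt y ⊤ (hfin y).lt_top
  obtain ⟨M, hM, -⟩ := EReal.lt_iff_exists_real_btwn.mp hz₀
  obtain ⟨κ, C, hκ, hcoer⟩ := hcoer y
  have hc₀₁' : c₀ < c₁ := by exact_mod_cast hc₀₁
  have hc₁M : c₁ < M := by exact_mod_cast (hc₁.trans_le (hle y lam₀ μ₀ hlam₀)).trans hM
  -- A value below `c₀` at some multipliers is pulled towards the reference point `(lam₀, μ₀)`, of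
  -- value below `M`. With weight `θ` on that point, convexity gives at most `c₁`, while the first
  -- multiplier stays above `θ * lam₀`, away from 0.
  set θ := (c₁ - c₀) / (M - c₀) with hθ
  have hθ0 : 0 < θ := div_pos (by linarith) (by linarith)
  have hθ1 : θ < 1 := (div_lt_one (by linarith)).mpr (by linarith)
  have hθc : θ * M + (1 - θ) * c₀ = c₁ := by
    have : θ * (M - c₀) = c₁ - c₀ := div_mul_cancel₀ _ (by linarith)
    linarith
  -- At distance `r` from the reference point coercivity at `y` pushes the cost above `M`. Its
  -- constants belong to `y` alone, so the bound is carried to nearby `y'` only on a compact set.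
  set r := max 1 ((M + C) / κ + lam₀ + |μ₀| + 1) with hr
  have hr0 : 0 < r := lt_max_of_lt_left one_pos
  set R := r / (1 - θ) with hR
  have hRr : (1 - θ) * R = r := mul_div_cancel₀ _ (by linarith)
  have hR0 : 0 < R := div_pos hr0 (by linarith)
  have hrR : r ≤ R := by nlinarith
  set Q : Set (ℝ × ℝ) := Icc (θ * lam₀) (lam₀ + R) ×ˢ Icc (μ₀ - R) (μ₀ + R) with hQ
  have hQc : IsCompact Q := isCompact_Icc.prod isCompact_Icc
  have hQpos : ∀ z ∈ Q, 0 < z.1 := fun z hz => (mul_pos hθ0 hlam₀).trans_le hz.1.1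
  have hQ'c : IsCompact (Q ∩ {z | r ≤ |z.1 - lam₀| + |z.2 - μ₀|}) :=
    hQc.inter_right (isClosed_le continuous_const (by fun_prop))
  have hev1 : ∀ᶠ y' in nhds y, ∀ z ∈ Q, (c₁ : EReal) < F y' z.1 z.2 :=
    hQc.eventually_forall_of_forall_eventually fun z hz =>
      (hcont y z.1 z.2 (hQpos z hz)).tendsto.eventually_const_lt
        (hc₁.trans_le (hle y _ _ (hQpos z hz)))
  have hev2 : ∀ᶠ y' in nhds y, ∀ z ∈ Q ∩ {z | r ≤ |z.1 - lam₀| + |z.2 - μ₀|},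
      (M : EReal) < F y' z.1 z.2 := by
    refine hQ'c.eventually_forall_of_forall_eventually fun z hz => ?_
    have hzpos := hQpos z hz.1
    refine (hcont y z.1 z.2 hzpos).tendsto.eventually_const_lt (lt_of_lt_of_le ?_
      (hcoer z.1 z.2 hzpos))
    rw [EReal.coe_lt_coe_iff]
    have h1 : r ≤ |z.1 - lam₀| + |z.2 - μ₀| := hz.2
    have h2 : |z.1 - lam₀| ≤ z.1 + lam₀ := by
      rw [abs_le]; constructor <;> linarith
    have h3 : |z.2 - μ₀| ≤ |z.2| + |μ₀| := abs_sub _ _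
    have h4 : (M + C) / κ + lam₀ + |μ₀| + 1 ≤ r := le_max_right _ _
    have h5 : (M + C) / κ < z.1 + |z.2| := by linarith
    rw [div_lt_iff₀ hκ] at h5
    linarith
  filter_upwards [hev1, hev2, (hcont1 y lam₀ μ₀ hlam₀).tendsto.eventually_lt_const hM]
    with y' h1 h2 h3
  refine hcc₀.trans_le (le_iInf₂ fun lam hlam => le_iInf fun μ => ?_)
  by_contra! hcon
  have hseg : ∀ s, (1 - s) * lam₀ + s * lam - lam₀ = s * (lam - lam₀) ∧
      (1 - s) * μ₀ + s * μ - μ₀ = s * (μ - μ₀) := fun s => ⟨by ring, by ring⟩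
  have hmem : ∀ s, 0 ≤ s → s ≤ 1 - θ → s * (|lam - lam₀| + |μ - μ₀|) ≤ R →
      ((1 - s) * lam₀ + s * lam, (1 - s) * μ₀ + s * μ) ∈ Q := by
    intro s hs0 hs1 hsR
    have hl : s * (lam - lam₀) ≤ s * |lam - lam₀| := mul_le_mul_of_nonneg_left (le_abs_self _) hs0
    have hm1 : s * (μ - μ₀) ≤ s * |μ - μ₀| := mul_le_mul_of_nonneg_left (le_abs_self _) hs0
    have hm2 : s * (-(μ - μ₀)) ≤ s * |μ - μ₀| := mul_le_mul_of_nonneg_left (neg_le_abs _) hs0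
    have hn1 := mul_nonneg hs0 (abs_nonneg (lam - lam₀))
    have hn2 := mul_nonneg hs0 (abs_nonneg (μ - μ₀))
    obtain ⟨e1, e2⟩ := hseg s
    refine ⟨⟨?_, ?_⟩, ⟨?_, ?_⟩⟩ <;> simp only
    · nlinarith [mul_nonneg hs0 hlam.le, mul_le_mul_of_nonneg_right hs1 hlam₀.le]
    all_goals linarith
  -- A near point is moved by the fraction `1 - θ` and contradicts the bound `c₁` on `Q`. A far one
  -- is moved to distance exactly `r`, where convexity gives at most `M`; `R = r / (1 - θ)` keeps
  -- that fraction below `1 - θ`.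
  rcases le_or_gt (|lam - lam₀| + |μ - μ₀|) R with hd | hd
  · have hin := hmem (1 - θ) (by linarith) le_rfl (by nlinarith)
    have hle' := hconv y' lam₀ μ₀ lam μ M c₀ (1 - θ) hlam₀ hlam h3.le hcon.le (by linarith)
      (by linarith)
    rw [sub_sub_cancel, hθc] at hle'
    rw [sub_sub_cancel] at hin
    exact absurd hle' (not_le.mpr (h1 _ hin))
  · have hd0 := hR0.trans hd
    set s := r / (|lam - lam₀| + |μ - μ₀|) with hs
    have hsd : s * (|lam - lam₀| + |μ - μ₀|) = r := div_mul_cancel₀ _ hd0.ne'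
    have hs0 : 0 ≤ s := (div_pos hr0 hd0).le
    have hs1 : s ≤ 1 - θ := by
      rw [hs, div_le_iff₀ hd0]
      nlinarith
    have hin := hmem s hs0 hs1 (by linarith)
    have hle' := hconv y' lam₀ μ₀ lam μ M c₀ s hlam₀ hlam h3.le hcon.le hs0 (by linarith)
    have hlt' := h2 _ ⟨hin, by
      obtain ⟨e1, e2⟩ := hseg s
      simp only [mem_ofPred_eq]
      rw [e1, e2, abs_mul, abs_mul, abs_of_nonneg hs0, ← mul_add, hsd]⟩
    have := hlt'.trans_le hle'
    rw [EReal.coe_lt_coe_iff] at this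
    nlinarith

/-! ### Robust games. -/

section Robust

variable {Ω : Type*} [MeasurableSpace Ω] {m : Measure Ω} {f : ℝ → EReal}

/-- **Strong duality** for `f`-divergence uncertainty sets; both values are finite. -/
theorem exists_worstCaseLoss_eq_minReducedCost [IsProbabilityMeasure m]
    (hf : IsDivergenceGenerator f) {ρ : ℝ} (hρ : 0 < ρ) {X : Ω → ℝ}
    (hX : ∀ m' ∈ uncertaintySet f ρ m, Integrable X m') :
    ∃ V : ℝ, worstCaseLoss f ρ m X = V ∧ minReducedCost f ρ m X = V := by
  have hm : m ∈ uncertaintySet f ρ m := self_mem_uncertaintySet hf hρ.le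
  have hbot : worstCaseLoss f ρ m X ≠ ⊥ := by
    refine ((EReal.bot_lt_coe (∫ ω, X ω ∂m)).trans_le ?_).ne'
    exact le_iSup₂ (f := fun m' (_ : m' ∈ uncertaintySet f ρ m) =>
      ((∫ ω, X ω ∂m' : ℝ) : EReal)) m hm
  have hV := EReal.coe_toReal (worstCaseLoss_lt_top hf hρ.le hX).ne hbot
  refine ⟨_, hV.symm, le_antisymm (minReducedCost_le hf hρ (hX m hm) hV.ge) ?_⟩
  rw [hV]
  exact le_iInf₂ fun lam hlam => le_iInf fun μ => worstCaseLoss_le_reducedCost hf hX hlam μ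

/-- A supremum of functions affine in the multipliers is convex. Real upper bounds in place of
values avoid arithmetic with infinities. -/
theorem reducedCost_segment_le [IsProbabilityMeasure m] (hf : IsDivergenceGenerator f) {ρ : ℝ}
    {X : Ω → ℝ} (hX : Integrable X m) {lam₀ μ₀ lam₁ μ₁ M c s : ℝ} (hlam₀ : 0 < lam₀)
    (hlam₁ : 0 < lam₁) (hM : reducedCost f ρ m X lam₀ μ₀ ≤ M)
    (hc : reducedCost f ρ m X lam₁ μ₁ ≤ c) (hs0 : 0 ≤ s) (hs1 : s ≤ 1) :
    reducedCost f ρ m X ((1 - s) * lam₀ + s * lam₁) ((1 - s) * μ₀ + s * μ₁) ≤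
      (((1 - s) * M + s * c : ℝ) : EReal) := by
  have hlam : 0 < (1 - s) * lam₀ + s * lam₁ := by
    rcases hs0.eq_or_lt with rfl | h
    · simpa using hlam₀
    · have := mul_pos h hlam₁
      have := mul_nonneg (sub_nonneg.mpr hs1) hlam₀.le
      linarith
  rw [reducedCost_le_iff hf hX hlam]
  rw [reducedCost_le_iff hf hX hlam₀] at hM
  rw [reducedCost_le_iff hf hX hlam₁] at hc
  intro t ht
  have hi1 : Integrable (fun ω => (t ω).1) m := (t.map Prod.fst).integrable_of_isFiniteMeasure
  have hi2 : Integrable (fun ω => (t ω).2) m := (t.map Prod.snd).integrable_of_isFiniteMeasure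
  have hiX : Integrable (fun ω => (t ω).1 * X ω) m := by
    simpa using SimpleFunc.integrable_fst_mul_sub t hX 0
  have h0 := mul_le_mul_of_nonneg_left (hM t ht) (sub_nonneg.mpr hs1)
  have h1 := mul_le_mul_of_nonneg_left (hc t ht) hs0
  rw [integral_lagrangian hiX hi1 hi2] at h0 h1 ⊢
  linarith

/-- Test with the constant densities `1 - t * δ` for `μ ≥ 0` and `1 + t * δ` for `μ ≤ 0`: the mass
defect yields `t * δ * |μ|`, and for small `t` half of `lam * ρ` survives. -/
theorem exists_coercive_le_reducedCost [IsProbabilityMeasure m] (hf : IsDivergenceGenerator f)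
    {ρ : ℝ} (hρ : 0 < ρ) {X : Ω → ℝ} (hX : Integrable X m) :
    ∃ κ C : ℝ, 0 < κ ∧ ∀ lam μ, 0 < lam →
      ((κ * (lam + |μ|) - C : ℝ) : EReal) ≤ reducedCost f ρ m X lam μ := by
  obtain ⟨δ, hδ, hδ1, hδ2⟩ := hf.exists_near_one
  have hδ1' : 0 ≤ 1 - δ := hf.nonneg_of_ne_top hδ1
  set c₁ := (f 1).toReal with hc₁
  set D := |(f (1 - δ)).toReal - c₁| + |(f (1 + δ)).toReal - c₁| with hD
  have hD0 : 0 ≤ D := by positivity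
  -- Chosen so that `t ≤ 1` and `t * D ≤ ρ / 2`, also when `D = 0`.
  set t := ρ / (ρ + 2 * D) with ht
  have htpos : 0 < t := by positivity
  have ht1 : t ≤ 1 := by
    rw [ht, div_le_one (by positivity)]
    linarith
  have htD : t * D ≤ ρ / 2 := by
    rw [ht, div_mul_eq_mul_div, div_le_iff₀ (by positivity)]
    nlinarith
  have hconst : ∀ p ∈ realEpigraph f, ∀ lam μ, 0 < lam →
      ((lam * (ρ + c₁) + μ + (p.1 * (∫ ω, X ω ∂m - μ) - lam * p.2) : ℝ) : EReal) ≤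
        reducedCost f ρ m X lam μ := by
    intro p hp lam μ hlam
    have hXμ : Integrable (fun ω => X ω - μ) m := hX.sub (integrable_const μ)
    have h1 := le_reducedCost (ρ := ρ) (X := X) (μ := μ) hf hlam (Z := fun _ => p.1)
      (R := fun _ => p.2) (.of_forall fun _ => hp)
      ((hXμ.const_mul p.1).sub (integrable_const _))
    rwa [integral_sub (hXμ.const_mul p.1) (integrable_const _), integral_const_mul,
      integral_sub hX (integrable_const μ), integral_const, integral_const, probReal_univ,
      one_smul, one_smul] at h1
  have hmix : ∀ x, f x ≠ ⊤ →
      ((1 - t) * 1 + t * x, (1 - t) * c₁ + t * (f x).toReal) ∈ realEpigraph f := fun x hx =>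
    hf.convex_realEpigraph (hf.mem_realEpigraph hf.one_ne_top) (hf.mem_realEpigraph hx)
      (sub_nonneg.mpr ht1) htpos.le (by ring)
  refine ⟨min (ρ / 2) (t * δ), 2 * |∫ ω, X ω ∂m|, lt_min (by linarith) (by positivity),
    fun lam μ hlam => ?_⟩
  have hκ1 : min (ρ / 2) (t * δ) * lam ≤ ρ / 2 * lam :=
    mul_le_mul_of_nonneg_right (min_le_left _ _) hlam.le
  have hκ2 : min (ρ / 2) (t * δ) * |μ| ≤ t * δ * |μ| :=
    mul_le_mul_of_nonneg_right (min_le_right _ _) (abs_nonneg _)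
  have htδ : t * δ ≤ 1 := by nlinarith
  have htδ0 : 0 ≤ t * δ := by positivity
  have hX1 := neg_abs_le (∫ ω, X ω ∂m)
  have hX0 := abs_nonneg (∫ ω, X ω ∂m)
  have hrange : ∀ x, 0 ≤ x → x ≤ 2 → -(2 * |∫ ω, X ω ∂m|) ≤ x * ∫ ω, X ω ∂m := by
    intro x hx0 hx2
    nlinarith [mul_le_mul_of_nonneg_left hX1 hx0, mul_le_mul_of_nonneg_right hx2 hX0]
  have hdev : ∀ x, |(f x).toReal - c₁| ≤ D → lam * (t * ((f x).toReal - c₁)) ≤ lam * (ρ / 2) := by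
    intro x hx
    refine mul_le_mul_of_nonneg_left (le_trans ?_ htD) hlam.le
    exact mul_le_mul_of_nonneg_left ((le_abs_self _).trans hx) htpos.le
  rcases le_total 0 μ with hμ | hμ
  · refine le_trans ?_ (hconst _ (hmix _ hδ1) lam μ hlam)
    rw [EReal.coe_le_coe_iff]
    rw [abs_of_nonneg hμ] at hκ2 ⊢
    have h1 := hdev (1 - δ) (le_add_of_nonneg_right (abs_nonneg _))
    have h2 := hrange ((1 - t) * 1 + t * (1 - δ)) (by linarith) (by linarith)
    simp only
    linarith
  · refine le_trans ?_ (hconst _ (hmix _ hδ2) lam μ hlam)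
    rw [EReal.coe_le_coe_iff]
    rw [abs_of_nonpos hμ] at hκ2 ⊢
    have h1 := hdev (1 + δ) (le_add_of_nonneg_left (abs_nonneg _))
    have h2 := hrange ((1 - t) * 1 + t * (1 + δ)) (by linarith) (by linarith)
    simp only
    linarith

theorem continuousOn_minReducedCost [IsProbabilityMeasure m] (hf : IsDivergenceGenerator f)
    {ρ : ℝ} (hρ : 0 < ρ) {Y : Type*} [TopologicalSpace Y] {A : Set Y} {X : Y → Ω → ℝ}
    (hX : ∀ y ∈ A, ∀ m' ∈ uncertaintySet f ρ m, Integrable (X y) m')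
    (hcont : ContinuousOn (fun z : Y × ℝ × ℝ => reducedCost f ρ m (X z.1) z.2.1 z.2.2)
      (A ×ˢ Ioi (0 : ℝ) ×ˢ (univ : Set ℝ))) :
    ContinuousOn (fun y => minReducedCost f ρ m (X y)) A := by
  rw [continuousOn_iff_continuous_domRestrict]
  have hXm : ∀ y : A, Integrable (X y) m := fun y =>
    hX y y.2 m (self_mem_uncertaintySet hf hρ.le)
  refine continuous_iInf_multipliers (Y := A) (F := fun y lam μ => reducedCost f ρ m (X y) lam μ)
    (fun y lam μ hlam => ?_)
    (fun y lam₀ μ₀ lam₁ μ₁ M c s h0 h1 hM hc hs0 hs1 =>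
      reducedCost_segment_le hf (hXm y) h0 h1 hM hc hs0 hs1)
    (fun y => exists_coercive_le_reducedCost hf hρ (hXm y)) (fun y => ?_)
  · have hopen : IsOpen {z : A × ℝ × ℝ | 0 < z.2.1} := isOpen_lt continuous_const (by fun_prop)
    refine ContinuousOn.continuousAt (s := {z : A × ℝ × ℝ | 0 < z.2.1}) ?_ (hopen.mem_nhds hlam)
    exact hcont.comp (f := fun z : A × ℝ × ℝ => ((z.1 : Y), z.2.1, z.2.2))
      (by fun_prop) fun z hz => ⟨z.1.2, hz, mem_univ _⟩
  · obtain ⟨V, -, hV⟩ := exists_worstCaseLoss_eq_minReducedCost hf hρ (hX y y.2)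
    exact ne_of_eq_of_ne hV (EReal.coe_ne_top V)

/-- Existence of robust equilibria when the minimized reduced costs are continuous, and quasiconvex
in the own action. -/
theorem exists_isRobustPureEquilibrium {ι : Type*} [Fintype ι] [DecidableEq ι] {E : ι → Type*}
    [∀ j, AddCommGroup (E j)] [∀ j, Module ℝ (E j)] [∀ j, TopologicalSpace (E j)]
    [∀ j, ContinuousAdd (E j)] [∀ j, ContinuousSMul ℝ (E j)] [IsProbabilityMeasure m]
    (hf : IsDivergenceGenerator f) {ρ : ℝ} (hρ : 0 < ρ) {A : ∀ j, Set (E j)}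
    (hne : ∀ j, (A j).Nonempty) (hcompact : ∀ j, IsCompact (A j)) (hconvex : ∀ j, Convex ℝ (A j))
    {l : ι → (∀ j, E j) → Ω → ℝ}
    (hint : ∀ j, ∀ a ∈ univ.pi A, ∀ m' ∈ uncertaintySet f ρ m, Integrable (l j a) m')
    (hcont : ∀ j, ContinuousOn (fun a => minReducedCost f ρ m (l j a)) (univ.pi A))
    (hq : ∀ j, ∀ a ∈ univ.pi A, QuasiconvexOn ℝ (A j)
      fun x => minReducedCost f ρ m (l j (Function.update a j x))) :
    ∃ a, IsRobustPureEquilibrium f ρ m A l a := by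
  -- By strong duality both costs are real on the action set, so `toReal` loses nothing there.
  let u : ι → (∀ j, E j) → ℝ := fun j a => (minReducedCost f ρ m (l j a)).toReal
  have hu : ∀ j, ∀ a ∈ univ.pi A, minReducedCost f ρ m (l j a) = (u j a : EReal) ∧
      worstCaseLoss f ρ m (l j a) = (u j a : EReal) := by
    intro j a ha
    obtain ⟨V, h1, h2⟩ := exists_worstCaseLoss_eq_minReducedCost hf hρ (hint j a ha)
    have : u j a = V := by simp only [u, h2, EReal.toReal_coe]
    rw [this]
    exact ⟨h2, h1⟩
  have huc : ∀ j, ContinuousOn (u j) (univ.pi A) := fun j =>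
    EReal.continuousOn_toReal.comp (hcont j) fun a ha => by
      simp [(hu j a ha).1]
  have huq : ∀ j, ∀ a ∈ univ.pi A,
      QuasiconvexOn ℝ (A j) fun x => u j (Function.update a j x) := by
    intro j a ha r
    convert hq j a ha (r : EReal) using 1
    ext x
    refine and_congr_right fun hx => ?_
    simp only
    rw [(hu j _ (update_mem_univ_pi ha hx)).1, EReal.coe_le_coe_iff]
  obtain ⟨a, ha, hle⟩ := exists_pure_equilibrium hne hcompact hconvex huc huq
  refine ⟨a, ha, fun j b hb => ?_⟩
  rw [(hu j a ha).2, (hu j _ (update_mem_univ_pi ha hb)).2]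
  exact EReal.coe_le_coe_iff.mpr (hle j b hb)

end Robust

/-- The alternative between the two assumptions becomes a pair of implications. The first reduces to
the second by minimising out the multipliers. -/
theorem mainTheorem3 {ι : Type*} [Fintype ι] [DecidableEq ι]
    {E : ι → Type*} [∀ j, NormedAddCommGroup (E j)] [∀ j, NormedSpace ℝ (E j)]
    [∀ j, FiniteDimensional ℝ (E j)]
    {Ω : Type*} [MeasurableSpace Ω] (m : Measure Ω) [IsProbabilityMeasure m]
    (f : ℝ → EReal) (hf : IsDivergenceGenerator f) (ρ : ℝ) (hρ : 0 < ρ)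
    (A : ∀ j, Set (E j)) (hne : ∀ j, (A j).Nonempty) (hcompact : ∀ j, IsCompact (A j))
    (hconvex : ∀ j, Convex ℝ (A j))
    (l : ι → (∀ j, E j) → Ω → ℝ)
    (hint : ∀ j, ∀ a ∈ univ.pi A, ∀ m' ∈ uncertaintySet f ρ m, Integrable (l j a) m') :
    -- the reduced cost as a function of the variables `z = (a, lam, μ)`, `z_j = (a_j, lam, μ)`
    ((∀ j,
        ContinuousOn
          (fun z : (∀ k, E k) × ℝ × ℝ => reducedCost f ρ m (l j z.1) z.2.1 z.2.2)
          (univ.pi A ×ˢ Ioi (0 : ℝ) ×ˢ (univ : Set ℝ)) ∧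
        ∀ a ∈ univ.pi A, QuasiconvexOn ℝ (A j ×ˢ Ioi (0 : ℝ) ×ˢ (univ : Set ℝ))
          (fun z : E j × ℝ × ℝ =>
            reducedCost f ρ m (l j (Function.update a j z.1)) z.2.1 z.2.2)) →
      ∃ a, IsRobustPureEquilibrium f ρ m A l a) ∧
    -- the reduced cost as a function of the action profile, the multipliers being minimized out
    ((∀ j,
        ContinuousOn (fun a => minReducedCost f ρ m (l j a)) (univ.pi A) ∧
        ∀ a ∈ univ.pi A, QuasiconvexOn ℝ (A j)
          (fun x => minReducedCost f ρ m (l j (Function.update a j x)))) →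
      ∃ a, IsRobustPureEquilibrium f ρ m A l a) := by
  constructor
  · intro h
    exact exists_isRobustPureEquilibrium hf hρ hne hcompact hconvex hint
      (fun j => continuousOn_minReducedCost hf hρ (hint j) (h j).1)
      (fun j a ha => quasiconvexOn_iInf_multipliers ((h j).2 a ha) (hconvex j))
  · intro h
    exact exists_isRobustPureEquilibrium hf hρ hne hcompact hconvex hint (fun j => (h j).1)
      (fun j => (h j).2)
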